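/- Let $\mathsf{Prop}$ be a finite or countable set of atoms and let $A=\{1,\dots,n\}$, $n\ge 1$, be a finite non-empty set of agents; a group is a non-empty $I\subseteq A$, and $i$ stands for the group $\{i\}$. Let $\alpha$ range over the groups $\{i\}$ ($i\in A$) and $A$. The language $\mathcal{L}_{KB_{i,A}}$ is given by $$\phi ::= p \mid \neg\phi \mid \phi\wedge\phi \mid B_\alpha\phi \mid K_\alpha\phi \qquad (p\in\mathsf{Prop}),$$ with $\to$ defined as usual and $\langle B_\alpha\rangle\phi:=\neg B_\alpha\neg\phi$. A multi-agent topo-e-model $(X,\Pi_i,\tau_i,\llbracket\cdot\rrbracket)_{i\in A}$ consists of a set $X$, for each $i\in A$ a partition $\Pi_i$ of $X$ and a topology $\tau_i$ on $X$ with $\Pi_i\subseteq\tau_i$, and a set $\llbracket p\rrbracket\subseteq X$ for each atom $p$. Let $\Pi_i(x)$ be the cell of $x$ in $\Pi_i$. For a group $I$ put $\Pi_I(x)=\bigcap_{i\in I}\Pi_i(x)$ and let $\tau_I$ be the topology generated by $\bigcup_{i\in I}\tau_i$, with closure operator $Cl_I$. For $P\subseteq X$ let $$B_I(P)=\{x\in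 X\mid \exists U\in\tau_I:\ U\subseteq P,\ \Pi_I(x)\subseteq Cl_I(U)\},$$ $$K_I(P)=\{x\in X\mid \exists U\in\tau_I:\ x\in U\subseteq P,\ \Pi_I(x)\subseteq Cl_I(U)\}.$$ Formulas are interpreted by $\llbracket\neg\phi\rrbracket=X\setminus\llbracket\phi\rrbracket$, $\llbracket\phi\wedge\psi\rrbracket=\llbracket\phi\rrbracket\cap\llbracket\psi\rrbracket$, $\llbracket B_\alpha\phi\rrbracket=B_\alpha(\llbracket\phi\rrbracket)$ and $\llbracket K_\alpha\phi\rrbracket=K_\alpha(\llbracket\phi\rrbracket)$. A formula is valid if it is true at every state of every multi-agent topo-e-model. The proof system $\mathbf{KB}_{i,A}$ consists of the axioms and rules of normal modal logic for each $K_\alpha$ and $B_\alpha$ (propositional tautologies, modus ponens, distribution over $\to$, necessitation) together with the axioms - $K_\alpha\phi\to\phi$; $K_\alpha\phi\to K_\alpha K_\alpha\phi$; $B_\alpha\phi\to\neg B_\alpha\neg\phi$; $B_\alpha\phi\to K_\alpha B_\alpha\phi$; $\neg B_\alpha\phi\to K_\alpha\neg B_\alpha\phi$; $K_\alpha\phi\to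 B_\alpha\phi$; $B_\alpha\phi\to B_\alpha K_\alpha\phi$ (Stalnaker's axioms); - $B_i\phi\to K_A B_i\phi$ (Super-Introspection); - $(K_i\phi\wedge B_A\phi)\to K_A\phi$ (Weak Monotonicity); - $\bigl(\bigwedge_{i\in A}K_i\phi_i\bigr)\to\langle B_A\rangle\bigl(\bigwedge_{i\in A}\phi_i\bigr)$ (Consistency of group Belief with Distributed knowledge), for all formulas $\phi,\phi_i$ and all $i\in A$. **Theorem.** $\mathbf{KB}_{i,A}$ is sound and complete for $\mathcal{L}_{KB_{i,A}}$ with respect to multi-agent topo-e-models: a formula is provable in $\mathbf{KB}_{i,A}$ if and only if it is valid. Moreover the logic is decidable: for every injective numbering of the atoms by natural numbers, there is an algorithm that, given (the Gödel number of) a formula, decides whether it is valid. -/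

import Mathlib

universe u v

namespace TopoE

open scoped Topology


/-! ### Syntax

The agents are the elements of `Fin n`, where `n` is positive; a group is a non-empty set of agents.
-/

/-- The modality indices `α ∈ {A} ∪ A`: groups that are a single agent or the full group `A`.
If there is only one agent then the two coincide. -/
abbrev Idx (n : ℕ) : Type :=
  {I : Finset (Fin n) // I = Finset.univ ∨ ∃ i, I = {i}}

/-- The group `{i}`. -/
def single {n : ℕ} (i : Fin n) : Idx n := ⟨{i}, Or.inr ⟨i, rfl⟩⟩

/-- The full group `A`. -/
def full (n : ℕ) : Idx n := ⟨Finset.univ, Or.inl rfl⟩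

/-- The language of knowledge and belief for individuals and the full group. -/
inductive Formula (P : Type u) (n : ℕ) : Type u
  | atom (p : P) : Formula P n
  | neg (φ : Formula P n) : Formula P n
  | and (φ ψ : Formula P n) : Formula P n
  | bel (I : Idx n) (φ : Formula P n) : Formula P n
  | know (I : Idx n) (φ : Formula P n) : Formula P n

namespace Formula

variable {P : Type u} {n : ℕ}

/-- Material implication, as an abbreviation. -/
def imp (φ ψ : Formula P n) : Formula P n := neg (and φ (neg ψ))

/-- Doxastic possibility `⟨B_I⟩ φ`, the dual of belief. -/
def posBel (I : Idx n) (φ : Formula P n) : Formula P n := neg (bel I (neg φ))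

/-- The conjunction `(⋯(f 0 ∧ f 1) ∧ ⋯) ∧ f (n - 1)` over all agents. -/
def conj [NeZero n] (f : Fin n → Formula P n) : Formula P n :=
  (List.finRange n).tail.foldl (fun ψ i => and ψ (f i)) (f 0)

/-- `φ` is an instance of a propositional tautology: it is true under every assignment of truth
values to formulas that respects negation and conjunction. -/
def IsTautology (φ : Formula P n) : Prop :=
  ∀ t : Formula P n → Prop,
    (∀ ψ, t (neg ψ) ↔ ¬ t ψ) → (∀ ψ χ, t (and ψ χ) ↔ (t ψ ∧ t χ)) → t φ

end Formula

/-! ### The proof system -/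

open Formula in
/-- Derivability in the proof system for the knowledge and belief of individuals and of the full
group. -/
inductive Provable {P : Type u} {n : ℕ} [NeZero n] : Formula P n → Prop
  -- normal modal logic for `K` and `B`
  | taut (φ : Formula P n) : IsTautology φ → Provable φ
  | modusPonens (φ ψ : Formula P n) : Provable (imp φ ψ) → Provable φ → Provable ψ
  | distK (I : Idx n) (φ ψ : Formula P n) :
      Provable (imp (know I (imp φ ψ)) (imp (know I φ) (know I ψ)))
  | distB (I : Idx n) (φ ψ : Formula P n) :
      Provable (imp (bel I (imp φ ψ)) (imp (bel I φ) (bel I ψ)))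
  | necK (I : Idx n) (φ : Formula P n) : Provable φ → Provable (know I φ)
  | necB (I : Idx n) (φ : Formula P n) : Provable φ → Provable (bel I φ)
  -- Stalnaker's axioms
  | truthK (I : Idx n) (φ : Formula P n) : Provable (imp (know I φ) φ)
  | posIntroK (I : Idx n) (φ : Formula P n) : Provable (imp (know I φ) (know I (know I φ)))
  | consB (I : Idx n) (φ : Formula P n) : Provable (imp (bel I φ) (neg (bel I (neg φ))))
  | strongPosIntro (I : Idx n) (φ : Formula P n) : Provable (imp (bel I φ) (know I (bel I φ)))
  | strongNegIntro (I : Idx n) (φ : Formula P n) :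
      Provable (imp (neg (bel I φ)) (know I (neg (bel I φ))))
  | knowBel (I : Idx n) (φ : Formula P n) : Provable (imp (know I φ) (bel I φ))
  | fullBel (I : Idx n) (φ : Formula P n) : Provable (imp (bel I φ) (bel I (know I φ)))
  -- group axioms
  | superIntro (i : Fin n) (φ : Formula P n) :
      Provable (imp (bel (single i) φ) (know (full n) (bel (single i) φ)))
  | weakMono (i : Fin n) (φ : Formula P n) :
      Provable (imp (and (know (single i) φ) (bel (full n) φ)) (know (full n) φ))
  | consBelDist (f : Fin n → Formula P n) :
      Provable (imp (conj fun i => know (single i) (f i)) (posBel (full n) (conj f)))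

/-! ### Models and semantics -/

/-- A multi-agent topological evidence model on the set of states `X`. The information partition
of agent `i` is given as the equivalence relation `part i`, whose classes are the cells. -/
structure Model (P : Type u) (n : ℕ) (X : Type v) where
  part : Fin n → Setoid X
  top : Fin n → TopologicalSpace X
  val : P → Set X
  /-- Hard evidence is evidence: every partition cell is open. -/
  isOpen_cell : ∀ i x, IsOpen[top i] {y | part i x y}

namespace Model

variable {P : Type u} {n : ℕ} {X : Type v} (M : Model P n X)

/-- The cell of `x` in the partition of the group `I`: the intersection of the members' cells. -/
def cell (I : Finset (Fin n)) (x : X) : Set X := ⋂ i ∈ I, {y | M.part i x y}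

/-- The evidential topology of the group `I`: the topology generated by the union of the
members' topologies. -/
abbrev groupTop (I : Finset (Fin n)) : TopologicalSpace X :=
  TopologicalSpace.generateFrom {U | ∃ i ∈ I, IsOpen[M.top i] U}

/-- Belief: some open `U ⊆ S` is dense in the current cell. -/
def B (I : Finset (Fin n)) (S : Set X) : Set X :=
  {x | ∃ U : Set X, IsOpen[M.groupTop I] U ∧ U ⊆ S ∧
    M.cell I x ⊆ @closure X (M.groupTop I) U}

/-- Knowledge: some open `U ⊆ S` that contains the current state is dense in the current cell. -/
def K (I : Finset (Fin n)) (S : Set X) : Set X :=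
  {x | ∃ U : Set X, IsOpen[M.groupTop I] U ∧ x ∈ U ∧ U ⊆ S ∧
    M.cell I x ⊆ @closure X (M.groupTop I) U}

/-- The interpretation of formulas as sets of states. -/
def interp : Formula P n → Set X
  | .atom p => M.val p
  | .neg φ => (interp φ)ᶜ
  | .and φ ψ => interp φ ∩ interp ψ
  | .bel I φ => M.B I.1 (interp φ)
  | .know I φ => M.K I.1 (interp φ)

end Model

/-- `φ` is valid: true at every state of every topo-e-model with states in `Type v`. -/
def Valid {P : Type u} {n : ℕ} (φ : Formula P n) : Prop :=
  ∀ (X : Type v) (M : Model P n X) (x : X), x ∈ M.interp φ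

/-! ### Decidability -/

/-- The number of a modality index: the bit mask of the group. -/
def Idx.code {n : ℕ} (I : Idx n) : ℕ := ∑ i ∈ I.1, 2 ^ (i : ℕ)

/-- The Gödel number of a formula, relative to a numbering `e` of the atoms. -/
def Formula.code {P : Type u} {n : ℕ} (e : P → ℕ) : Formula P n → ℕ
  | .atom p => Nat.pair 0 (e p)
  | .neg φ => Nat.pair 1 (φ.code e)
  | .and φ ψ => Nat.pair 2 (Nat.pair (φ.code e) (ψ.code e))
  | .bel I φ => Nat.pair 3 (Nat.pair I.code (φ.code e))
  | .know I φ => Nat.pair 4 (Nat.pair I.code (φ.code e))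

/-- A set of formulas is decidable: for every numbering of the atoms (without repetitions), there
is a Turing-computable function that decides membership of a formula, given its Gödel number. -/
def IsDecidable {P : Type u} {n : ℕ} (L : Set (Formula P n)) : Prop :=
  ∀ e : P → ℕ, Function.Injective e →
    ∃ d : ℕ → Bool, Computable d ∧ ∀ φ : Formula P n, d (φ.code e) = true ↔ φ ∈ L

end TopoE

/-!
Soundness is checked directly in topo-e-models: the cell of a group is open in the group topology, so
two open sets that are dense in a cell have an intersection that is dense in it.

Completeness and decidability come from one intermediate notion. Fix a formula with Gödel number `c`.
A *type* is a finite set of Gödel numbers, coded by the binary digits of a natural number, and a set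
of types is *saturated* if its members satisfy local conditions and it contains a witness for every
belief or item of knowledge that one of its members lacks. The number `c` is *refutable* if some type
in a saturated set omits it (`Refutable`). Three facts give the theorem.

* If a formula is not provable then it is refutable (`refutable_of_not_provable`): the restrictions of
  all maximal consistent sets form a saturated set. Weak monotonicity ensures that a witness for
  missing group knowledge of something that the group believes is accessible for every agent, and
  consistency of group belief with distributed knowledge provides, for each type, a final type of the
  group that is accessible for every agent.
* If a formula is refutable then it is not valid (`not_valid_of_refutable`). A saturated set is a
  relational frame (`Frame`) in which agent `i` has a preorder `R i` whose cells have a final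
  cluster, and the group has a preorder `D` that may be smaller than the intersection of all `R i`.
  The topo-e-model needs exactly that intersection. So the worlds are copied, with a position in `ℤ`
  and a clock in `ℕ` for every agent. A move in the cell of agent `i` changes only the counters of
  `i`, and preserves the sum of all positions minus a label of the world, where the label identifies
  the cell of the group; a move along the preorder of `i` advances the clock of `i` unless it is a
  move along `D`. With at least two agents, a move that all agents can make changes no counter, and
  therefore is a move along `D` (`Frame.forall_le_iff`); a move inside the cells of all agents stays
  in the cell of the group (`Frame.forall_cellSetoid_iff`). With one agent the group adds nothing.
* Refutability is primitive recursive (`primrecPred_refutable`), as it is defined from arithmetic by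
  bounded quantification.

Hence a formula is valid if and only if it is provable, and if and only if it is not refutable.
-/

namespace TopoE

open scoped Topology

/-! ### Soundness -/

section Soundness

variable {P : Type u} {n : ℕ} {X : Type v} (M : Model P n X)

namespace Model

theorem mem_cell {I : Finset (Fin n)} {x y : X} : y ∈ M.cell I x ↔ ∀ i ∈ I, M.part i x y := by
  simp [cell]

theorem self_mem_cell (I : Finset (Fin n)) (x : X) : x ∈ M.cell I x :=
  M.mem_cell.2 fun i _ => (M.part i).refl x

theorem cell_eq {I : Finset (Fin n)} {x y : X} (h : y ∈ M.cell I x) :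
    M.cell I y = M.cell I x := by
  rw [mem_cell] at h
  ext z
  simp only [mem_cell]
  exact ⟨fun hz i hi => (M.part i).trans (h i hi) (hz i hi),
    fun hz i hi => (M.part i).trans ((M.part i).symm (h i hi)) (hz i hi)⟩

theorem isOpen_groupTop {I : Finset (Fin n)} {i : Fin n} (hi : i ∈ I) {U : Set X}
    (hU : IsOpen[M.top i] U) : IsOpen[M.groupTop I] U :=
  TopologicalSpace.isOpen_generateFrom_of_mem ⟨i, hi, hU⟩

theorem groupTop_singleton (i : Fin n) : M.groupTop {i} = M.top i := by
  simp [groupTop, TopologicalSpace.generateFrom_setOfPred_isOpen]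

theorem isOpen_cell_groupTop (I : Finset (Fin n)) (x : X) : IsOpen[M.groupTop I] (M.cell I x) :=
  @isOpen_biInter_finset X _ (M.groupTop I) I _
    fun i hi => M.isOpen_groupTop hi (M.isOpen_cell i x)

theorem subset_closure_iff {I : Finset (Fin n)} {C U : Set X} :
    C ⊆ @closure X (M.groupTop I) U ↔
      ∀ y ∈ C, ∀ V, IsOpen[M.groupTop I] V → y ∈ V → (V ∩ U).Nonempty := by
  let _ := M.groupTop I
  exact forall₂_congr fun y _ => mem_closure_iff

theorem K_subset_B (I : Finset (Fin n)) (S : Set X) : M.K I S ⊆ M.B I S :=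
  fun _ ⟨U, hU, _, hUS, hd⟩ => ⟨U, hU, hUS, hd⟩

theorem K_subset (I : Finset (Fin n)) (S : Set X) : M.K I S ⊆ S :=
  fun _ ⟨_, _, hx, hUS, _⟩ => hUS hx

theorem B_mono {I : Finset (Fin n)} {S T : Set X} (h : S ⊆ T) : M.B I S ⊆ M.B I T :=
  fun _ ⟨U, hU, hUS, hd⟩ => ⟨U, hU, hUS.trans h, hd⟩

theorem K_mono {I : Finset (Fin n)} {S T : Set X} (h : S ⊆ T) : M.K I S ⊆ M.K I T :=
  fun _ ⟨U, hU, hx, hUS, hd⟩ => ⟨U, hU, hx, hUS.trans h, hd⟩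

theorem mem_B_congr {I : Finset (Fin n)} {S : Set X} {x y : X} (h : y ∈ M.cell I x) :
    y ∈ M.B I S ↔ x ∈ M.B I S := by
  simp only [B, Set.mem_ofPred_eq, M.cell_eq h]

theorem mem_K_of_cell_subset {I : Finset (Fin n)} {S : Set X} {x : X} (h : M.cell I x ⊆ S) :
    x ∈ M.K I S :=
  ⟨M.cell I x, M.isOpen_cell_groupTop I x, M.self_mem_cell I x, h,
    @subset_closure X (M.groupTop I) _⟩

/-- Two open sets that are dense in a cell have an intersection that is dense in it: the cell is
itself open, so that the usual argument can be carried out inside the cell. -/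
theorem dense_inter {I : Finset (Fin n)} {x : X} {U V : Set X} (hU : IsOpen[M.groupTop I] U)
    (hdU : M.cell I x ⊆ @closure X (M.groupTop I) U)
    (hdV : M.cell I x ⊆ @closure X (M.groupTop I) V) :
    M.cell I x ⊆ @closure X (M.groupTop I) (U ∩ V) := by
  let _ := M.groupTop I
  rw [subset_closure_iff] at *
  intro y hy W hW hyW
  obtain ⟨z, ⟨hzW, hzC⟩, hzU⟩ :=
    hdU y hy (W ∩ M.cell I x) (hW.inter (M.isOpen_cell_groupTop I x)) ⟨hyW, hy⟩
  obtain ⟨w, ⟨hwW, hwU⟩, hwV⟩ := hdV z hzC (W ∩ U) (hW.inter hU) ⟨hzW, hzU⟩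
  exact ⟨w, hwW, hwU, hwV⟩

theorem B_inter {I : Finset (Fin n)} {S T : Set X} : M.B I S ∩ M.B I T ⊆ M.B I (S ∩ T) := by
  rintro x ⟨⟨U, hU, hUS, hdU⟩, V, hV, hVT, hdV⟩
  exact ⟨U ∩ V, @IsOpen.inter X (M.groupTop I) _ _ hU hV, Set.inter_subset_inter hUS hVT,
    M.dense_inter hU hdU hdV⟩

theorem K_inter {I : Finset (Fin n)} {S T : Set X} : M.K I S ∩ M.K I T ⊆ M.K I (S ∩ T) := by
  rintro x ⟨⟨U, hU, hxU, hUS, hdU⟩, V, hV, hxV, hVT, hdV⟩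
  exact ⟨U ∩ V, @IsOpen.inter X (M.groupTop I) _ _ hU hV, ⟨hxU, hxV⟩,
    Set.inter_subset_inter hUS hVT, M.dense_inter hU hdU hdV⟩

theorem not_mem_B_compl {I : Finset (Fin n)} {S : Set X} {x : X} (h : x ∈ M.B I S) :
    x ∉ M.B I Sᶜ := by
  intro h'
  obtain ⟨U, hU, hUS, hd⟩ := M.B_inter ⟨h, h'⟩
  obtain ⟨z, -, hz⟩ := M.subset_closure_iff.1 hd x (M.self_mem_cell I x) Set.univ
    (@isOpen_univ X (M.groupTop I)) trivial
  exact (hUS hz).2 (hUS hz).1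

theorem inter_cell_subset_K {I : Finset (Fin n)} {S U : Set X} {x : X}
    (hU : IsOpen[M.groupTop I] U) (hUS : U ⊆ S)
    (hd : M.cell I x ⊆ @closure X (M.groupTop I) U) : U ∩ M.cell I x ⊆ M.K I S := by
  rintro y ⟨hyU, hyC⟩
  exact ⟨U, hU, hyU, hUS, by rwa [M.cell_eq hyC]⟩

theorem B_subset_B_K (I : Finset (Fin n)) (S : Set X) : M.B I S ⊆ M.B I (M.K I S) := by
  rintro x ⟨U, hU, hUS, hd⟩
  exact ⟨U ∩ M.cell I x, @IsOpen.inter X (M.groupTop I) _ _ hU (M.isOpen_cell_groupTop I x),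
    M.inter_cell_subset_K hU hUS hd,
    M.dense_inter hU hd (@subset_closure X (M.groupTop I) _)⟩

theorem K_subset_K_K (I : Finset (Fin n)) (S : Set X) : M.K I S ⊆ M.K I (M.K I S) := by
  rintro x ⟨U, hU, hxU, hUS, hd⟩
  exact ⟨U ∩ M.cell I x, @IsOpen.inter X (M.groupTop I) _ _ hU (M.isOpen_cell_groupTop I x),
    ⟨hxU, M.self_mem_cell I x⟩, M.inter_cell_subset_K hU hUS hd,
    M.dense_inter hU hd (@subset_closure X (M.groupTop I) _)⟩

theorem mem_interp_imp {φ ψ : Formula P n} {x : X} :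
    x ∈ M.interp (φ.imp ψ) ↔ (x ∈ M.interp φ → x ∈ M.interp ψ) := by
  simp [Formula.imp, interp]

end Model

theorem foldl_and_iff {t : Formula P n → Prop}
    (hand : ∀ ψ χ, t (.and ψ χ) ↔ t ψ ∧ t χ) (f : Fin n → Formula P n) (l : List (Fin n))
    (a : Formula P n) :
    t (l.foldl (fun ψ i => .and ψ (f i)) a) ↔ t a ∧ ∀ i ∈ l, t (f i) := by
  induction l generalizing a with
  | nil => simp
  | cons i l ih => simp [ih, hand, and_assoc]

theorem conj_iff [NeZero n] {t : Formula P n → Prop}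
    (hand : ∀ ψ χ, t (.and ψ χ) ↔ t ψ ∧ t χ) (f : Fin n → Formula P n) :
    t (Formula.conj f) ↔ ∀ i, t (f i) := by
  rw [Formula.conj, foldl_and_iff hand]
  have h : List.finRange n = 0 :: (List.finRange n).tail := by
    obtain ⟨m, rfl⟩ := Nat.exists_eq_succ_of_ne_zero (NeZero.ne n)
    simp [List.finRange_succ]
  constructor
  · rintro ⟨h0, ht⟩ i
    have hi : i ∈ List.finRange n := List.mem_finRange i
    rw [h] at hi
    rcases List.mem_cons.1 hi with rfl | hi
    exacts [h0, ht i hi]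
  · exact fun h => ⟨h 0, fun i _ => h i⟩

/-- Soundness, for a single model. -/
theorem Provable.mem_interp [NeZero n] {φ : Formula P n} (h : Provable φ) (x : X) :
    x ∈ M.interp φ := by
  induction h generalizing x with
  | taut φ h =>
    exact h (fun ψ => x ∈ M.interp ψ) (fun _ => Iff.rfl) (fun _ _ => Iff.rfl)
  | modusPonens φ ψ _ _ ih₁ ih₂ => exact M.mem_interp_imp.1 (ih₁ x) (ih₂ x)
  | distK I φ ψ =>
    simp only [Model.mem_interp_imp]
    intro h₁ h₂
    exact M.K_mono (fun y hy => M.mem_interp_imp.1 hy.1 hy.2) (M.K_inter ⟨h₁, h₂⟩)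
  | distB I φ ψ =>
    simp only [Model.mem_interp_imp]
    intro h₁ h₂
    exact M.B_mono (fun y hy => M.mem_interp_imp.1 hy.1 hy.2) (M.B_inter ⟨h₁, h₂⟩)
  | necK I φ _ ih => exact M.mem_K_of_cell_subset fun y _ => ih y
  | necB I φ _ ih => exact M.K_subset_B _ _ (M.mem_K_of_cell_subset fun y _ => ih y)
  | truthK I φ => exact M.mem_interp_imp.2 fun h => M.K_subset _ _ h
  | posIntroK I φ => exact M.mem_interp_imp.2 fun h => M.K_subset_K_K _ _ h
  | consB I φ => exact M.mem_interp_imp.2 fun h => M.not_mem_B_compl h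
  | strongPosIntro I φ =>
    exact M.mem_interp_imp.2 fun h =>
      M.mem_K_of_cell_subset fun y hy => (M.mem_B_congr hy).2 h
  | strongNegIntro I φ =>
    exact M.mem_interp_imp.2 fun h =>
      M.mem_K_of_cell_subset fun y hy hyB => h ((M.mem_B_congr hy).1 hyB)
  | knowBel I φ => exact M.mem_interp_imp.2 fun h => M.K_subset_B _ _ h
  | fullBel I φ => exact M.mem_interp_imp.2 fun h => M.B_subset_B_K _ _ h
  | superIntro i φ =>
    refine M.mem_interp_imp.2 fun h => M.mem_K_of_cell_subset fun y hy => ?_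
    refine (M.mem_B_congr (I := {i}) ?_).2 h
    rw [Model.mem_cell] at hy ⊢
    exact fun j _ => hy j (Finset.mem_univ j)
  | weakMono i φ =>
    refine M.mem_interp_imp.2 fun h => ?_
    obtain ⟨⟨U, hU, hxU, hUS, -⟩, V, hV, hVS, hd⟩ := h
    have hU' : IsOpen[M.groupTop Finset.univ] U := by
      refine M.isOpen_groupTop (Finset.mem_univ i) ?_
      rwa [← M.groupTop_singleton]
    -- `U` provides the current state and `V` the density.
    exact ⟨U ∪ V, @IsOpen.union X _ _ (M.groupTop _) hU' hV, Or.inl hxU,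
      Set.union_subset hUS hVS,
      hd.trans (@closure_mono X (M.groupTop _) _ _ Set.subset_union_right)⟩
  | consBelDist f =>
    refine M.mem_interp_imp.2 fun h => ?_
    have hand : ∀ (y : X) (ψ χ : Formula P n),
        y ∈ M.interp (.and ψ χ) ↔ y ∈ M.interp ψ ∧ y ∈ M.interp χ := fun _ _ _ => Iff.rfl
    rw [conj_iff (t := fun ψ => x ∈ M.interp ψ) (hand x)] at h
    choose U hU hxU hUS hd using h
    rintro ⟨V, hV, hVS, hdV⟩
    have hW : IsOpen[M.groupTop Finset.univ] (⋂ i, U i) := by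
      refine @isOpen_iInter_of_finite X _ (M.groupTop _) _ _ fun i => ?_
      refine M.isOpen_groupTop (Finset.mem_univ i) ?_
      rw [← M.groupTop_singleton]
      exact hU i
    obtain ⟨z, hzU, hzV⟩ := M.subset_closure_iff.1 hdV x (M.self_mem_cell _ x) _ hW
      (Set.mem_iInter.2 hxU)
    refine hVS hzV ?_
    rw [conj_iff (t := fun ψ => z ∈ M.interp ψ) (hand z)]
    exact fun i => hUS i (Set.mem_iInter.1 hzU i)

end Soundness

/-! ### Alexandroff topologies -/

/-- The Alexandroff topology of a relation: the open sets are those closed under it. -/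
@[reducible]
def upTopology {X : Type v} (r : X → X → Prop) : TopologicalSpace X where
  IsOpen U := ∀ x ∈ U, ∀ y, r x y → y ∈ U
  isOpen_univ _ _ _ _ := trivial
  isOpen_inter _ _ hU hV x hx y h := ⟨hU x hx.1 y h, hV x hx.2 y h⟩
  isOpen_sUnion _ h x := fun ⟨U, hU, hx⟩ y hxy => ⟨U, hU, h U hU x hx y hxy⟩

namespace Model

variable {P : Type u} {n : ℕ} {X : Type v} (M : Model P n X)

/-- For Alexandroff topologies of preorders, the group topology is the Alexandroff topology of the
intersection of the members' preorders. -/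
theorem isOpen_groupTop_iff {le : Fin n → X → X → Prop} (htop : ∀ i, M.top i = upTopology (le i))
    (hrefl : ∀ i x, le i x x) (htrans : ∀ i x y z, le i x y → le i y z → le i x z)
    (I : Finset (Fin n)) (U : Set X) :
    IsOpen[M.groupTop I] U ↔ ∀ x ∈ U, ∀ y, (∀ i ∈ I, le i x y) → y ∈ U := by
  constructor
  · have h : upTopology (fun x y => ∀ i ∈ I, le i x y) ≤ M.groupTop I := by
      refine le_generateFrom ?_
      rintro V ⟨i, hi, hV⟩
      rw [htop] at hV
      exact fun x hx y hxy => hV x hx y (hxy i hi)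
    exact fun hU => h U hU
  · intro hU
    let _ := M.groupTop I
    have h : U = ⋃ x ∈ U, ⋂ i ∈ I, {y | le i x y} := by
      ext z
      simp only [Set.mem_iUnion, Set.mem_iInter, exists_prop]
      exact ⟨fun hz => ⟨z, hz, fun i _ => hrefl i z⟩, fun ⟨x, hx, hxz⟩ => hU x hx z hxz⟩
    rw [h]
    refine isOpen_biUnion fun x _ => isOpen_biInter_finset fun i hi => M.isOpen_groupTop hi ?_
    rw [htop]
    exact fun y hy z hyz => htrans i x y z hy hyz

/-- The group topology is the Alexandroff topology of the preorder `r`, and in the cell of `x` the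
set `F` consists of states that are final for `r`: it is closed under `r` and can be reached from
everywhere in the cell. -/
structure IsFinalIn (I : Finset (Fin n)) (r : X → X → Prop) (x : X) (F : Set X) : Prop where
  isOpen_iff : ∀ U, IsOpen[M.groupTop I] U ↔ ∀ y ∈ U, ∀ z, r y z → z ∈ U
  refl : ∀ y, r y y
  trans : ∀ y z w, r y z → r z w → r y w
  subset_cell : F ⊆ M.cell I x
  closed : ∀ y ∈ F, ∀ z, r y z → z ∈ F
  cofinal : ∀ y ∈ M.cell I x, ∃ z ∈ F, r y z

namespace IsFinalIn

variable {M} {I : Finset (Fin n)} {r : X → X → Prop} {x : X} {F S : Set X}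

theorem dense (h : M.IsFinalIn I r x F) {U : Set X} (hU : F ⊆ U) :
    M.cell I x ⊆ @closure X (M.groupTop I) U := by
  rw [subset_closure_iff]
  intro y hy V hV hyV
  obtain ⟨z, hz, hyz⟩ := h.cofinal y hy
  exact ⟨z, (h.isOpen_iff V).1 hV y hyV z hyz, hU hz⟩

/-- Belief is truth in all final states, for a proposition `S` that cannot distinguish a final state
from some state above any of its successors. -/
theorem mem_B_iff (h : M.IsFinalIn I r x F)
    (hS : ∀ y ∈ F, ∀ z, r y z → ∃ w, r z w ∧ (w ∈ S → y ∈ S)) : x ∈ M.B I S ↔ F ⊆ S := by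
  constructor
  · rintro ⟨U, hU, hUS, hd⟩ y hy
    obtain ⟨z, hyz, hzU⟩ := M.subset_closure_iff.1 hd y (h.subset_cell hy) {z | r y z}
      ((h.isOpen_iff _).2 fun z hz w hzw => h.trans y z w hz hzw) (h.refl y)
    obtain ⟨w, hzw, hw⟩ := hS y hy z hyz
    exact hw (hUS ((h.isOpen_iff U).1 hU z hzU w hzw))
  · exact fun hF => ⟨F, (h.isOpen_iff F).2 h.closed, hF, h.dense subset_rfl⟩

theorem mem_K_iff (h : M.IsFinalIn I r x F)
    (hS : ∀ y ∈ F, ∀ z, r y z → ∃ w, r z w ∧ (w ∈ S → y ∈ S)) :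
    x ∈ M.K I S ↔ (∀ y, r x y → y ∈ S) ∧ F ⊆ S := by
  constructor
  · intro hx
    refine ⟨?_, (h.mem_B_iff hS).1 (M.K_subset_B I S hx)⟩
    obtain ⟨U, hU, hxU, hUS, -⟩ := hx
    exact fun y hxy => hUS ((h.isOpen_iff U).1 hU x hxU y hxy)
  · rintro ⟨hr, hF⟩
    refine ⟨{y | r x y} ∪ F, (h.isOpen_iff _).2 ?_, Or.inl (h.refl x), Set.union_subset hr hF,
      h.dense Set.subset_union_right⟩
    rintro y (hy | hy) z hyz
    exacts [Or.inl (h.trans x y z hy hyz), Or.inr (h.closed y hy z hyz)]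

end IsFinalIn

end Model

/-! ### From relational frames to topo-e-models -/

/-- A relational frame, in which the relation of the full group need not be the intersection of the
relations of the agents. Agent `i` has information cells (the classes of `E i`), a preorder `R i`
for knowledge, and in each cell a final cluster, which supports belief; `fin i` is the union of
these clusters. For the full group, knowledge is truth at all successors for `D` and in the final
set of the cell, where `D` may be a proper part of the intersection of the relations `R i`. -/
structure Frame (n : ℕ) (W : Type v) where
  E : Fin n → Setoid W
  R : Fin n → W → W → Prop
  fin : Fin n → Set W
  EA : Setoid W
  D : W → W → Prop
  finA : Set W
  R_refl : ∀ i x, R i x x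
  R_trans : ∀ i x y z, R i x y → R i y z → R i x z
  E_of_R : ∀ i x y, R i x y → E i x y
  R_of_fin : ∀ i x y, E i x y → y ∈ fin i → R i x y
  fin_closed : ∀ i x y, x ∈ fin i → R i x y → y ∈ fin i
  exists_fin : ∀ i x, ∃ y, E i x y ∧ y ∈ fin i
  E_of_EA : ∀ i x y, EA x y → E i x y
  D_refl : ∀ x, D x x
  D_trans : ∀ x y z, D x y → D y z → D x z
  EA_of_D : ∀ x y, D x y → EA x y
  R_of_D : ∀ i x y, D x y → R i x y
  finA_closed : ∀ x y, x ∈ finA → D x y → y ∈ finA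
  exists_finA : ∀ x, ∃ y, D x y ∧ y ∈ finA

namespace Frame

/-- The states of the topo-e-model built from a frame: copies of the worlds, each equipped with two
counters for every agent. -/
structure State (n : ℕ) (W : Type v) : Type v where
  world : W
  pos : Fin n → ℤ
  clock : Fin n → ℕ

variable {n : ℕ} {W : Type v} (F : Frame n W) (c : W → ℤ)

/-- Successors for `D`, except that a final world has no proper successors. So an open set that is
dense in a cell cannot omit any final world, and belief of the group is truth in all of them. -/
def strictD (x y : W) : Prop := F.D x y ∧ (x ∈ F.finA → x = y)

/-- A move inside the cell of agent `i` changes only the counters of `i`, and it keeps the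
difference between the sum of all positions and the label `c` of the world. So a move that is inside
the cells of two different agents changes no counter, and it keeps the label. -/
def cellSetoid (i : Fin n) : Setoid (State n W) where
  r x y := F.E i x.world y.world ∧ (∀ j, j ≠ i → x.pos j = y.pos j ∧ x.clock j = y.clock j) ∧
    ∑ j, x.pos j - c x.world = ∑ j, y.pos j - c y.world
  iseqv :=
    { refl := fun _ => ⟨(F.E i).refl _, fun _ _ => ⟨rfl, rfl⟩, rfl⟩
      symm := fun ⟨h₁, h₂, h₃⟩ => ⟨(F.E i).symm h₁,
        fun j hj => ⟨(h₂ j hj).1.symm, (h₂ j hj).2.symm⟩, h₃.symm⟩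
      trans := fun ⟨h₁, h₂, h₃⟩ ⟨k₁, k₂, k₃⟩ => ⟨(F.E i).trans h₁ k₁,
        fun j hj => ⟨(h₂ j hj).1.trans (k₂ j hj).1, (h₂ j hj).2.trans (k₂ j hj).2⟩,
        h₃.trans k₃⟩ }

/-- The evidence preorder of agent `i`. Along it the clock of `i` never goes back, and if it stands
still then the move has to be one of the full group; this makes the intersection of the
preorders of two different agents no larger than `strictD`. -/
def le (i : Fin n) (x y : State n W) : Prop :=
  F.cellSetoid c i x y ∧ F.R i x.world y.world ∧
    (x.clock i < y.clock i ∨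
      x.clock i = y.clock i ∧ x.pos i = y.pos i ∧ F.strictD x.world y.world)

variable {F c}

theorem strictD_trans {x y z : W} (h : F.strictD x y) (h' : F.strictD y z) : F.strictD x z := by
  refine ⟨F.D_trans _ _ _ h.1 h'.1, fun hx => ?_⟩
  obtain rfl := h.2 hx
  exact h'.2 hx

theorem le_refl (i : Fin n) (x : State n W) : F.le c i x x :=
  ⟨(F.cellSetoid c i).refl x, F.R_refl i _, Or.inr ⟨rfl, rfl, F.D_refl _, fun _ => rfl⟩⟩

theorem le_trans (i : Fin n) (x y z : State n W) (h : F.le c i x y) (h' : F.le c i y z) :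
    F.le c i x z := by
  obtain ⟨h₁, h₂, h₃⟩ := h
  obtain ⟨k₁, k₂, k₃⟩ := h'
  refine ⟨(F.cellSetoid c i).trans h₁ k₁, F.R_trans i _ _ _ h₂ k₂, ?_⟩
  rcases h₃ with h₃ | ⟨h₃, h₄, h₅⟩ <;> rcases k₃ with k₃ | ⟨k₃, k₄, k₅⟩
  · exact Or.inl (h₃.trans k₃)
  · exact Or.inl (h₃.trans_eq k₃)
  · exact Or.inl (h₃.trans_lt k₃)
  · exact Or.inr ⟨h₃.trans k₃, h₄.trans k₄, strictD_trans h₅ k₅⟩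

/-- Agent `i` can move to any world of its cell, with increasing clock: the position of `i`
compensates for the change of label. -/
def move (c : W → ℤ) (i : Fin n) (x : State n W) (w : W) : State n W where
  world := w
  pos := Function.update x.pos i (x.pos i + (c w - c x.world))
  clock := Function.update x.clock i (x.clock i + 1)

theorem cellSetoid_move {i : Fin n} {x : State n W} {w : W} (h : F.E i x.world w) :
    F.cellSetoid c i x (move c i x w) := by
  refine ⟨h, fun j hj => by simp [move, hj], ?_⟩
  have hs := Finset.sum_update_of_mem (Finset.mem_univ i) x.pos (x.pos i + (c w - c x.world))
  have hs' := Finset.add_sum_erase Finset.univ x.pos (Finset.mem_univ i)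
  rw [Finset.sdiff_singleton_eq_erase] at hs
  simp only [move]
  rw [hs]
  lia

theorem le_move {i : Fin n} {x : State n W} {w : W} (h : F.R i x.world w) :
    F.le c i x (move c i x w) :=
  ⟨cellSetoid_move (F.E_of_R i _ _ h), h, Or.inl (by simp [move])⟩

theorem le_of_strictD {i : Fin n} {x : State n W} {w : W} (hc : c x.world = c w)
    (h : F.strictD x.world w) : F.le c i x { x with world := w } :=
  ⟨⟨F.E_of_R i _ _ (F.R_of_D i _ _ h.1), fun _ _ => ⟨rfl, rfl⟩, by simp [hc]⟩,
    F.R_of_D i _ _ h.1, Or.inr ⟨rfl, rfl, h⟩⟩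

variable {P : Type u}

variable (F c) in
/-- The topo-e-model of a frame. -/
def model (val : P → Set W) : Model P n (State n W) where
  part := F.cellSetoid c
  top i := upTopology (F.le c i)
  val p := {x | x.world ∈ val p}
  isOpen_cell i _ _ hy _ hyz := (F.cellSetoid c i).trans hy hyz.1

theorem isOpen_groupTop_model (val : P → Set W) (I : Finset (Fin n)) (U : Set (State n W)) :
    IsOpen[(F.model c val).groupTop I] U ↔
      ∀ x ∈ U, ∀ y, (∀ i ∈ I, F.le c i x y) → y ∈ U :=
  (F.model c val).isOpen_groupTop_iff (fun _ => rfl) le_refl le_trans I U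

theorem mem_cell_model (val : P → Set W) (I : Finset (Fin n)) (x y : State n W) :
    y ∈ (F.model c val).cell I x ↔ ∀ i ∈ I, F.cellSetoid c i x y :=
  Model.mem_cell _

theorem isFinalIn_single (val : P → Set W) (i : Fin n) (x : State n W) :
    (F.model c val).IsFinalIn {i} (F.le c i) x
      {y | F.cellSetoid c i x y ∧ y.world ∈ F.fin i} where
  isOpen_iff U := by simpa using isOpen_groupTop_model (F := F) (c := c) val {i} U
  refl := le_refl i
  trans := le_trans i
  subset_cell y hy := by simpa [mem_cell_model] using hy.1
  closed y hy z hyz :=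
    ⟨(F.cellSetoid c i).trans hy.1 hyz.1, F.fin_closed i _ _ hy.2 hyz.2.1⟩
  cofinal y hy := by
    have hxy : F.cellSetoid c i x y := by simpa [mem_cell_model] using hy
    obtain ⟨w, hw, hwf⟩ := F.exists_fin i y.world
    exact ⟨move c i y w, ⟨(F.cellSetoid c i).trans hxy (cellSetoid_move hw), hwf⟩,
      le_move (F.R_of_fin i _ _ hw hwf)⟩

/-- The worlds of a final cluster see each other, so a move of agent `i` between them can be undone
up to the counters. -/
theorem single_back {i : Fin n} {x y z : State n W} {S : Set W}
    (hy : y ∈ {y | F.cellSetoid c i x y ∧ y.world ∈ F.fin i}) (hyz : F.le c i y z) :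
    ∃ w, F.le c i z w ∧ (w ∈ {x : State n W | x.world ∈ S} → y ∈ {x : State n W | x.world ∈ S}) :=
  ⟨move c i z y.world,
    le_move (F.R_of_fin i _ _ ((F.E i).symm (F.E_of_R i _ _ hyz.2.1)) hy.2), id⟩

theorem mem_B_single (val : P → Set W) (i : Fin n) (x : State n W) (S : Set W) :
    x ∈ (F.model c val).B {i} {y | y.world ∈ S} ↔
      ∀ w, F.E i x.world w → w ∈ F.fin i → w ∈ S := by
  rw [(isFinalIn_single val i x).mem_B_iff fun y hy z => single_back hy]
  exact ⟨fun h w hw hf => h (a := move c i x w) ⟨cellSetoid_move hw, hf⟩,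
    fun h y hy => h _ hy.1.1 hy.2⟩

theorem mem_K_single (val : P → Set W) (i : Fin n) (x : State n W) (S : Set W) :
    x ∈ (F.model c val).K {i} {y | y.world ∈ S} ↔ ∀ w, F.R i x.world w → w ∈ S := by
  rw [(isFinalIn_single val i x).mem_K_iff fun y hy z => single_back hy]
  exact ⟨fun h w hw => h.1 (move c i x w) (le_move hw),
    fun h => ⟨fun y hy => h _ hy.2.1, fun y hy => h _ (F.R_of_fin i _ _ hy.1.1 hy.2)⟩⟩

/-- The cell of the full group consists of the copies, with the same counters, of the worlds in the
cell of the group. For every counter there is an agent who cannot change it. -/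
theorem forall_cellSetoid_iff (hn : 1 < n) (hc : ∀ x y, c x = c y ↔ F.EA x y) (x y : State n W) :
    (∀ i, F.cellSetoid c i x y) ↔ y = { x with world := y.world } ∧ F.EA x.world y.world := by
  constructor
  · intro h
    have hpos : ∀ j, x.pos j = y.pos j ∧ x.clock j = y.clock j := by
      intro j
      have : Nontrivial (Fin n) := Fin.nontrivial_iff_two_le.2 hn
      obtain ⟨i, hi⟩ := exists_ne j
      exact (h i).2.1 j hi.symm
    have hp : x.pos = y.pos := funext fun j => (hpos j).1
    have hk : x.clock = y.clock := funext fun j => (hpos j).2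
    refine ⟨by rw [hp, hk], (hc _ _).1 ?_⟩
    have := (h ⟨0, by omega⟩).2.2
    rw [hp] at this
    lia
  · rintro ⟨hy, hE⟩ i
    rw [hy]
    exact ⟨F.E_of_EA i _ _ hE, fun _ _ => ⟨rfl, rfl⟩, by simp [(hc _ _).2 hE]⟩

/-- The intersection of the preorders of the agents is `strictD`, with the counters unchanged. -/
theorem forall_le_iff (hn : 1 < n) (hc : ∀ x y, c x = c y ↔ F.EA x y) (x y : State n W) :
    (∀ i, F.le c i x y) ↔ y = { x with world := y.world } ∧ F.strictD x.world y.world := by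
  constructor
  · intro h
    have hy := ((forall_cellSetoid_iff hn hc x y).1 fun i => (h i).1).1
    refine ⟨hy, ?_⟩
    rcases (h ⟨0, by omega⟩).2.2 with h' | ⟨-, -, h'⟩
    · rw [hy] at h'
      exact absurd h' (lt_irrefl _)
    · exact h'
  · rintro ⟨hy, hD⟩ i
    rw [hy]
    exact le_of_strictD ((hc _ _).2 (F.EA_of_D _ _ hD.1)) hD

theorem isFinalIn_univ (hn : 1 < n) (hc : ∀ x y, c x = c y ↔ F.EA x y) (val : P → Set W)
    (x : State n W) :
    (F.model c val).IsFinalIn Finset.univ (fun y z => ∀ i, F.le c i y z) x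
      {y | (∀ i, F.cellSetoid c i x y) ∧ y.world ∈ F.finA} where
  isOpen_iff U := by simpa using isOpen_groupTop_model (F := F) (c := c) val Finset.univ U
  refl y i := le_refl i y
  trans y z w h h' i := le_trans i y z w (h i) (h' i)
  subset_cell y hy := by simpa [mem_cell_model] using hy.1
  closed y hy z hyz := by
    refine ⟨fun i => (F.cellSetoid c i).trans (hy.1 i) (hyz i).1, ?_⟩
    exact F.finA_closed _ _ hy.2 ((forall_le_iff hn hc y z).1 hyz).2.1
  cofinal y hy := by
    have hxy : ∀ i, F.cellSetoid c i x y := by simpa [mem_cell_model] using hy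
    by_cases hyf : y.world ∈ F.finA
    · exact ⟨y, ⟨hxy, hyf⟩, fun i => le_refl i y⟩
    · obtain ⟨w, hw, hwf⟩ := F.exists_finA y.world
      have h : ∀ i, F.le c i y { y with world := w } := fun i =>
        le_of_strictD ((hc _ _).2 (F.EA_of_D _ _ hw)) ⟨hw, fun h => absurd h hyf⟩
      exact ⟨_, ⟨fun i => (F.cellSetoid c i).trans (hxy i) (h i).1, hwf⟩, h⟩

/-- A move of the full group from a final world does not change the world. -/
theorem univ_back (hn : 1 < n) (hc : ∀ x y, c x = c y ↔ F.EA x y) {x y z : State n W} {S : Set W}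
    (hy : y ∈ {y | (∀ i, F.cellSetoid c i x y) ∧ y.world ∈ F.finA})
    (hyz : ∀ i, F.le c i y z) :
    ∃ w, (∀ i, F.le c i z w) ∧
      (w ∈ {x : State n W | x.world ∈ S} → y ∈ {x : State n W | x.world ∈ S}) := by
  refine ⟨z, fun i => le_refl i z, fun hz => ?_⟩
  have := ((forall_le_iff hn hc y z).1 hyz).2.2 hy.2
  change y.world ∈ S
  rwa [this]

theorem mem_B_univ (hn : 1 < n) (hc : ∀ x y, c x = c y ↔ F.EA x y) (val : P → Set W)
    (x : State n W) (S : Set W) :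
    x ∈ (F.model c val).B Finset.univ {y | y.world ∈ S} ↔
      ∀ w, F.EA x.world w → w ∈ F.finA → w ∈ S := by
  rw [(isFinalIn_univ hn hc val x).mem_B_iff fun y hy z => univ_back hn hc hy]
  constructor
  · intro h w hw hf
    exact h (a := { x with world := w }) ⟨(forall_cellSetoid_iff hn hc _ _).2 ⟨rfl, hw⟩, hf⟩
  · exact fun h y hy => h _ ((forall_cellSetoid_iff hn hc _ _).1 hy.1).2 hy.2

theorem mem_K_univ (hn : 1 < n) (hc : ∀ x y, c x = c y ↔ F.EA x y) (val : P → Set W)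
    (x : State n W) (S : Set W) :
    x ∈ (F.model c val).K Finset.univ {y | y.world ∈ S} ↔
      (∀ w, F.D x.world w → w ∈ S) ∧ ∀ w, F.EA x.world w → w ∈ F.finA → w ∈ S := by
  rw [(isFinalIn_univ hn hc val x).mem_K_iff fun y hy z => univ_back hn hc hy,
    ← (isFinalIn_univ hn hc val x).mem_B_iff fun y hy z => univ_back hn hc hy,
    mem_B_univ hn hc]
  refine ⟨fun h => ⟨fun w hw => ?_, h.2⟩, fun h => ⟨fun y hy => ?_, h.2⟩⟩
  · by_cases hx : x.world ∈ F.finA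
    · exact h.2 w (F.EA_of_D _ _ hw) (F.finA_closed _ _ hx hw)
    · exact h.1 { x with world := w }
        ((forall_le_iff hn hc _ _).2 ⟨rfl, hw, fun h => absurd h hx⟩)
  · exact h.1 _ ((forall_le_iff hn hc _ _).1 hy).2.1

end Frame

/-! ### Maximal consistent sets -/

section Worlds

open Formula hiding and

variable {P : Type u} {n : ℕ} [NeZero n]

/-- Derivability from assumptions, without necessitation for the assumptions. -/
inductive Derivable (Γ : Set (Formula P n)) : Formula P n → Prop
  | assumption {φ : Formula P n} : φ ∈ Γ → Derivable Γ φ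
  | provable {φ : Formula P n} : Provable φ → Derivable Γ φ
  | modusPonens {φ ψ : Formula P n} : Derivable Γ (imp φ ψ) → Derivable Γ φ → Derivable Γ ψ

/-- A maximal consistent set, described as a Boolean valuation that contains all theorems. -/
structure IsWorld (Γ : Set (Formula P n)) : Prop where
  neg_mem : ∀ ψ, neg ψ ∈ Γ ↔ ψ ∉ Γ
  and_mem : ∀ ψ χ, Formula.and ψ χ ∈ Γ ↔ ψ ∈ Γ ∧ χ ∈ Γ
  mem_of_provable : ∀ ψ, Provable ψ → ψ ∈ Γ

omit [NeZero n] in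
theorem valuation_imp {t : Formula P n → Prop} (hneg : ∀ ψ, t (neg ψ) ↔ ¬ t ψ)
    (hand : ∀ ψ χ, t (Formula.and ψ χ) ↔ (t ψ ∧ t χ)) (φ ψ : Formula P n) :
    t (imp φ ψ) ↔ (t φ → t ψ) := by
  simp [imp, hneg, hand]

/-- Tautologies are provable; the valuations come with their value at implications. -/
theorem Provable.of_valuation {φ : Formula P n}
    (h : ∀ t : Formula P n → Prop, (∀ ψ, t (neg ψ) ↔ ¬ t ψ) →
      (∀ ψ χ, t (Formula.and ψ χ) ↔ (t ψ ∧ t χ)) → (∀ ψ χ, t (imp ψ χ) ↔ (t ψ → t χ)) → t φ) :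
    Provable φ :=
  .taut φ fun t hneg hand => h t hneg hand (valuation_imp hneg hand)

namespace Derivable

variable {Γ Δ : Set (Formula P n)} {φ ψ χ : Formula P n}

theorem provable_of_empty (h : Derivable (∅ : Set (Formula P n)) φ) : Provable φ := by
  induction h with
  | assumption h => exact h.elim
  | provable h => exact h
  | modusPonens _ _ ih₁ ih₂ => exact .modusPonens _ _ ih₁ ih₂

theorem mp_provable (h : Provable (imp φ ψ)) (h' : Derivable Γ φ) : Derivable Γ ψ :=
  .modusPonens (.provable h) h'

theorem mp_provable₂ (h : Provable (imp φ (imp ψ χ))) (h₁ : Derivable Γ φ)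
    (h₂ : Derivable Γ ψ) : Derivable Γ χ :=
  .modusPonens (.mp_provable h h₁) h₂

theorem deduction (h : Derivable (insert ψ Γ) φ) : Derivable Γ (imp ψ φ) := by
  induction h with
  | @assumption φ h =>
    rcases h with rfl | h
    · exact .provable (.of_valuation fun t _ _ himp => by simp [himp])
    · exact .mp_provable (.of_valuation fun t _ _ himp => by simp only [himp]; tauto)
        (.assumption h)
  | @provable φ h =>
    exact .mp_provable (.of_valuation fun t _ _ himp => by simp only [himp]; tauto) (.provable h)
  | @modusPonens φ χ _ _ ih₁ ih₂ =>
    exact .mp_provable₂ (.of_valuation fun t _ _ himp => by simp only [himp]; tauto) ih₁ ih₂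

theorem mono (h : Derivable Γ φ) (hΓ : Γ ⊆ Δ) : Derivable Δ φ := by
  induction h with
  | assumption h => exact .assumption (hΓ h)
  | provable h => exact .provable h
  | modusPonens _ _ ih₁ ih₂ => exact .modusPonens ih₁ ih₂

theorem exists_of_sUnion {C : Set (Set (Formula P n))} (hC : IsChain (· ⊆ ·) C)
    (hne : C.Nonempty) (h : Derivable (⋃₀ C) φ) : ∃ Γ ∈ C, Derivable Γ φ := by
  induction h with
  | assumption h =>
    obtain ⟨Γ, hΓ, hφ⟩ := h
    exact ⟨Γ, hΓ, .assumption hφ⟩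
  | provable h =>
    obtain ⟨Γ, hΓ⟩ := hne
    exact ⟨Γ, hΓ, .provable h⟩
  | modusPonens _ _ ih₁ ih₂ =>
    obtain ⟨Γ, hΓ, h₁⟩ := ih₁
    obtain ⟨Δ, hΔ, h₂⟩ := ih₂
    rcases hC.total hΓ hΔ with h | h
    · exact ⟨Δ, hΔ, .modusPonens (h₁.mono h) h₂⟩
    · exact ⟨Γ, hΓ, .modusPonens h₁ (h₂.mono h)⟩

end Derivable

/-- Lindenbaum's lemma. A set that is maximal among those not deriving `φ` is a world. -/
theorem exists_isWorld {Γ : Set (Formula P n)} {φ : Formula P n} (h : ¬ Derivable Γ φ) :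
    ∃ Δ, IsWorld Δ ∧ Γ ⊆ Δ ∧ φ ∉ Δ := by
  obtain ⟨Δ, hΓΔ, hΔ⟩ := zorn_subset_nonempty {Δ : Set (Formula P n) | ¬ Derivable Δ φ}
    (fun C hC hchain hne => ⟨⋃₀ C, fun hd => by
      obtain ⟨Δ, hΔ, hd'⟩ := hd.exists_of_sUnion hchain hne
      exact hC hΔ hd', fun s hs => Set.subset_sUnion_of_mem hs⟩) Γ h
  have hφ : ¬ Derivable Δ φ := hΔ.prop
  have hnot : ∀ ψ, ψ ∉ Δ → Derivable Δ (imp ψ φ) := by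
    intro ψ hψ
    by_contra hd
    have h' : ¬ Derivable (insert ψ Δ) φ := fun h => hd h.deduction
    exact hψ (hΔ.le_of_ge h' (Set.subset_insert ψ Δ) (Set.mem_insert ψ Δ))
  have hmem : ∀ ψ, Derivable Δ ψ → ψ ∈ Δ := by
    intro ψ hψ
    by_contra hn
    exact hφ (.modusPonens (hnot ψ hn) hψ)
  refine ⟨Δ, ⟨fun ψ => ⟨fun h₁ h₂ => hφ ?_, fun h => hmem _ ?_⟩,
    fun ψ χ => ⟨fun h => ⟨hmem _ ?_, hmem _ ?_⟩, fun h => hmem _ ?_⟩,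
    fun ψ hψ => hmem ψ (.provable hψ)⟩, hΓΔ, fun h => hφ (.assumption h)⟩
  · exact .mp_provable₂ (φ := neg ψ) (ψ := ψ)
      (.of_valuation fun t hneg _ himp => by simp only [himp, hneg]; tauto)
      (.assumption h₁) (.assumption h₂)
  · by_contra hn
    have hn' : Derivable Δ (imp (neg ψ) φ) := hnot _ fun h' => hn (.assumption h')
    exact hφ (.mp_provable₂
      (.of_valuation fun t hneg _ himp => by simp only [himp, hneg]; tauto) (hnot ψ h) hn')
  · exact .mp_provable (φ := Formula.and ψ χ)
      (.of_valuation fun t _ hand himp => by simp only [himp, hand]; tauto) (.assumption h)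
  · exact .mp_provable (φ := Formula.and ψ χ)
      (.of_valuation fun t _ hand himp => by simp only [himp, hand]; tauto) (.assumption h)
  · exact .mp_provable₂ (φ := ψ) (ψ := χ)
      (.of_valuation fun t _ hand himp => by simp only [himp, hand]; tauto)
      (.assumption h.1) (.assumption h.2)

namespace IsWorld

variable {Γ Δ : Set (Formula P n)} {φ ψ χ : Formula P n} {I : Idx n} {i : Fin n}

theorem imp_mem (h : IsWorld Γ) : imp φ ψ ∈ Γ ↔ (φ ∈ Γ → ψ ∈ Γ) :=
  valuation_imp h.neg_mem h.and_mem φ ψ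

theorem mp (h : IsWorld Γ) (hp : Provable (imp φ ψ)) (hφ : φ ∈ Γ) : ψ ∈ Γ :=
  h.imp_mem.1 (h.mem_of_provable _ hp) hφ

theorem know_derivable (h : IsWorld Γ) (hd : Derivable {χ | know I χ ∈ Γ} φ) :
    know I φ ∈ Γ := by
  induction hd with
  | assumption h => exact h
  | provable hp => exact h.mem_of_provable _ (.necK I _ hp)
  | modusPonens _ _ ih₁ ih₂ => exact h.imp_mem.1 (h.mp (.distK I _ _) ih₁) ih₂

theorem bel_derivable (h : IsWorld Γ) (hd : Derivable {χ | bel I χ ∈ Γ} φ) : bel I φ ∈ Γ := by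
  induction hd with
  | assumption h => exact h
  | provable hp => exact h.mem_of_provable _ (.necB I _ hp)
  | modusPonens _ _ ih₁ ih₂ => exact h.imp_mem.1 (h.mp (.distB I _ _) ih₁) ih₂

theorem know_mono (h : IsWorld Γ) (hp : Provable (imp φ ψ)) (hφ : know I φ ∈ Γ) :
    know I ψ ∈ Γ :=
  h.know_derivable (.mp_provable hp (.assumption hφ))

theorem bel_mono (h : IsWorld Γ) (hp : Provable (imp φ ψ)) (hφ : bel I φ ∈ Γ) : bel I ψ ∈ Γ :=
  h.bel_derivable (.mp_provable hp (.assumption hφ))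

theorem bel_neg_not_mem (h : IsWorld Γ) (hφ : bel I φ ∈ Γ) : bel I (neg φ) ∉ Γ :=
  (h.neg_mem _).1 (h.mp (.consB I φ) hφ)

/-- Beliefs that are preserved are also reflected, by introspection. -/
theorem bel_iff (h : IsWorld Γ) (h' : IsWorld Δ) (hb : ∀ χ, bel I χ ∈ Γ → bel I χ ∈ Δ)
    (χ : Formula P n) : bel I χ ∈ Γ ↔ bel I χ ∈ Δ := by
  refine ⟨hb χ, fun hχ => ?_⟩
  by_contra hn
  have h₁ : bel I (neg (bel I χ)) ∈ Γ :=
    h.mp (.knowBel I _) (h.mp (.strongNegIntro I χ) ((h.neg_mem _).2 hn))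
  have h₂ : bel I (bel I χ) ∈ Δ := h'.mp (.knowBel I _) (h'.mp (.strongPosIntro I χ) hχ)
  exact h'.bel_neg_not_mem h₂ (hb _ h₁)

/-- The canonical relation for knowledge. -/
def Sees (I : Idx n) (Γ Δ : Set (Formula P n)) : Prop :=
  (∀ χ, bel I χ ∈ Γ ↔ bel I χ ∈ Δ) ∧ ∀ χ, know I χ ∈ Γ → know I χ ∈ Δ

omit [NeZero n] in
/-- Worlds in the final cluster of their cell: those in which every belief is knowledge. -/
def IsFinal (I : Idx n) (Γ : Set (Formula P n)) : Prop := ∀ χ, bel I χ ∈ Γ → know I χ ∈ Γ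

theorem sees_of_know (h : IsWorld Γ) (h' : IsWorld Δ) (hk : ∀ χ, know I χ ∈ Γ → χ ∈ Δ) :
    Sees I Γ Δ :=
  ⟨h.bel_iff h' fun _ hχ => hk _ (h.mp (.strongPosIntro I _) hχ),
    fun _ hχ => hk _ (h.mp (.posIntroK I _) hχ)⟩

theorem sees_of_bel (h : IsWorld Γ) (h' : IsWorld Δ) (hb : ∀ χ, bel I χ ∈ Γ → χ ∈ Δ) :
    Sees I Γ Δ :=
  h.sees_of_know h' fun _ hχ => hb _ (h.mp (.knowBel I _) hχ)

theorem isFinal_of_bel (h : IsWorld Γ) (h' : IsWorld Δ) (hb : ∀ χ, bel I χ ∈ Γ → χ ∈ Δ) :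
    IsFinal I Δ :=
  fun χ hχ => hb _ (h.mp (.fullBel I _) (((h.sees_of_bel h' hb).1 χ).2 hχ))

/-- Super-introspection, for negative beliefs too. -/
theorem bel_single_iff_of_know_full (h : IsWorld Γ) (h' : IsWorld Δ)
    (hk : ∀ χ, know (full n) χ ∈ Γ → χ ∈ Δ) (i : Fin n) (χ : Formula P n) :
    bel (single i) χ ∈ Γ ↔ bel (single i) χ ∈ Δ :=
  h.bel_iff h' (fun _ hχ => hk _ (h.mp (.superIntro i _) hχ)) χ

theorem exists_know (h : IsWorld Γ) (hψ : know I ψ ∉ Γ) :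
    ∃ Δ, IsWorld Δ ∧ (∀ χ, know I χ ∈ Γ → χ ∈ Δ) ∧ ψ ∉ Δ :=
  exists_isWorld fun hd => hψ (h.know_derivable hd)

theorem exists_bel (h : IsWorld Γ) (hψ : bel I ψ ∉ Γ) :
    ∃ Δ, IsWorld Δ ∧ (∀ χ, bel I χ ∈ Γ → χ ∈ Δ) ∧ ψ ∉ Δ :=
  exists_isWorld fun hd => hψ (h.bel_derivable hd)

/-- A witness for missing group knowledge of something that the group believes is, by weak
monotonicity, a successor for every member: if `i` knows `χ`, then `i` also knows `χ ∨ ψ`, which the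
group believes, so that the group knows it. -/
theorem sees_single_of_know_full (h : IsWorld Γ) (h' : IsWorld Δ)
    (hk : ∀ χ, know (full n) χ ∈ Γ → χ ∈ Δ) (hb : bel (full n) ψ ∈ Γ) (hψ : ψ ∉ Δ) (i : Fin n) :
    Sees (single i) Γ Δ := by
  refine h.sees_of_know h' fun χ hχ => ?_
  have h₁ : know (single i) (imp (neg ψ) χ) ∈ Γ :=
    h.know_mono (.of_valuation fun t _ _ himp => by simp only [himp]; tauto) hχ
  have h₂ : bel (full n) (imp (neg ψ) χ) ∈ Γ :=
    h.bel_mono (.of_valuation fun t hneg _ himp => by simp only [himp, hneg]; tauto) hb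
  have h₃ := hk (imp (neg ψ) χ) (h.mp (.weakMono i _) ((h.and_mem _ _).2 ⟨h₁, h₂⟩))
  exact h'.imp_mem.1 h₃ ((h'.neg_mem _).2 hψ)

/-- By consistency of group belief with distributed knowledge, some final world of the group
contains everything that any member knows. -/
theorem exists_final_sees (h : IsWorld Γ) :
    ∃ Δ, IsWorld Δ ∧ (∀ χ, bel (full n) χ ∈ Γ → χ ∈ Δ) ∧
      ∀ i χ, know (single i) χ ∈ Γ → χ ∈ Δ := by
  -- Without atoms there are no formulas at all.
  by_cases hne : Nonempty (Formula P n)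
  swap
  · have := not_nonempty_iff.1 hne
    exact ⟨Γ, h, isEmptyElim, fun _ => isEmptyElim⟩
  obtain ⟨α⟩ := hne
  have htop : Provable (imp α α) := .of_valuation fun t _ _ himp => by simp only [himp]; tauto
  -- In such a derivation the beliefs used can be collected in one formula, and the knowledge used in
  -- one formula for each agent.
  have key : ∀ φ, Derivable
      ({χ | bel (full n) χ ∈ Γ} ∪ {χ | ∃ i, know (single i) χ ∈ Γ}) φ →
      ∃ (β : Formula P n) (f : Fin n → Formula P n), bel (full n) β ∈ Γ ∧
        (∀ i, know (single i) (f i) ∈ Γ) ∧ Provable (imp β (imp (conj f) φ)) := by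
    intro φ hd
    induction hd with
    | @assumption φ hφ =>
      rcases hφ with hφ | ⟨i, hφ⟩
      · exact ⟨φ, fun _ => imp α α, hφ, fun i => h.mem_of_provable _ (.necK _ _ htop),
          .of_valuation fun t _ _ himp => by simp only [himp]; tauto⟩
      · refine ⟨imp α α, Function.update (fun _ => imp α α) i φ,
          h.mem_of_provable _ (.necB _ _ htop), fun j => ?_,
          .of_valuation fun t _ hand himp => ?_⟩
        · by_cases hj : j = i
          · subst hj; simpa using hφ
          · simpa [hj] using h.mem_of_provable _ (.necK _ _ htop)
        · simp only [himp, conj_iff hand]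
          intro _ hf
          simpa using hf i
    | @provable φ hφ =>
      refine ⟨φ, fun _ => imp α α, h.mem_of_provable _ (.necB _ _ hφ),
        fun i => h.mem_of_provable _ (.necK _ _ htop),
        .of_valuation fun t _ _ himp => by simp only [himp]; tauto⟩
    | @modusPonens φ ψ _ _ ih₁ ih₂ =>
      obtain ⟨β, f, hβ, hf, hp⟩ := ih₁
      obtain ⟨γ, g, hγ, hg, hq⟩ := ih₂
      refine ⟨Formula.and β γ, fun i => Formula.and (f i) (g i), ?_, fun i => ?_, ?_⟩
      · exact h.bel_derivable (.mp_provable₂ (φ := β) (ψ := γ)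
          (.of_valuation fun t _ hand himp => by simp only [himp, hand]; tauto)
          (.assumption hβ) (.assumption hγ))
      · exact h.know_derivable (.mp_provable₂ (φ := f i) (ψ := g i)
          (.of_valuation fun t _ hand himp => by simp only [himp, hand]; tauto)
          (.assumption (hf i)) (.assumption (hg i)))
      · refine .modusPonens _ _ (.modusPonens _ _ (.of_valuation fun t _ hand himp => ?_) hp) hq
        simp only [himp, hand, conj_iff hand, forall_and]
        tauto
  have hcons : ¬ Derivable
      ({χ | bel (full n) χ ∈ Γ} ∪ {χ | ∃ i, know (single i) χ ∈ Γ}) (neg (imp α α)) := by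
    intro hd
    obtain ⟨β, f, hβ, hf, hp⟩ := key _ hd
    have hconj : conj (fun i => know (single i) (f i)) ∈ Γ :=
      (conj_iff (t := (· ∈ Γ)) h.and_mem _).2 hf
    refine (h.neg_mem _).1 (h.mp (.consBelDist f) hconj) (h.bel_mono ?_ hβ)
    refine .modusPonens _ _ (.of_valuation fun t hneg _ himp => ?_) hp
    simp only [himp, hneg]
    tauto
  obtain ⟨Δ, hΔ, hsub, -⟩ := exists_isWorld hcons
  exact ⟨Δ, hΔ, fun χ hχ => hsub (Or.inl hχ), fun i χ hχ => hsub (Or.inr ⟨i, hχ⟩)⟩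

/-- What a group believes is consistent. -/
theorem exists_bel_nonempty (h : IsWorld Γ) (I : Idx n) :
    ∃ Δ, IsWorld Δ ∧ ∀ χ, bel I χ ∈ Γ → χ ∈ Δ := by
  -- Without atoms there are no formulas at all.
  by_cases hne : Nonempty (Formula P n)
  swap
  · have := not_nonempty_iff.1 hne
    exact ⟨Γ, h, isEmptyElim⟩
  obtain ⟨α⟩ := hne
  have htop : Provable (imp α α) := .of_valuation fun t _ _ himp => by simp only [himp]; tauto
  obtain ⟨Δ, hΔ, hb, -⟩ := h.exists_bel
    (h.bel_neg_not_mem (h.mem_of_provable _ (.necB I _ htop)))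
  exact ⟨Δ, hΔ, hb⟩

end IsWorld

end Worlds

/-! ### Finite sets of types -/

/-- The `k`-th binary digit of `m` is `1`: the number `m` stands for the set of all such `k`. -/
def Has (m k : ℕ) : Prop := m / 2 ^ k % 2 = 1

theorem exists_has (p : ℕ → Prop) (N : ℕ) : ∃ m < 2 ^ N, ∀ k < N, Has m k ↔ p k := by
  classical
  refine ⟨Nat.ofBits fun i : Fin N => decide (p i), Nat.ofBits_lt_two_pow _, fun k hk => ?_⟩
  have h := Nat.testBit_ofBits_lt (fun i : Fin N => decide (p i)) k hk
  rw [Nat.testBit_eq_decide_div_mod_eq] at h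
  simpa [Has] using h

/-- The Gödel number of a belief formula, in terms of the numbers of the group and the formula. -/
def belCode (J k : ℕ) : ℕ := Nat.pair 3 (Nat.pair J k)

/-- The Gödel number of a knowledge formula. -/
def knowCode (J k : ℕ) : ℕ := Nat.pair 4 (Nat.pair J k)

/-- The types `S` and `T` agree on the beliefs of the group `J`, for formulas numbered up to `c`. -/
def SameBel (c J S T : ℕ) : Prop := ∀ k < c + 1, Has S (belCode J k) ↔ Has T (belCode J k)

/-- The transitive filtration of the canonical relation `IsWorld.Sees`. -/
def Access (c J S T : ℕ) : Prop :=
  SameBel c J S T ∧ ∀ k < c + 1, Has S (knowCode J k) → Has T (knowCode J k)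

/-- In the type `T` all beliefs of `J` are knowledge. -/
def FinalType (c J T : ℕ) : Prop := ∀ k < c + 1, Has T (belCode J k) → Has T (knowCode J k)

/-- The number of the full group. -/
def fullCode (n : ℕ) : ℕ := 2 ^ n - 1

/-- The types agree on the beliefs of all agents and of the full group. -/
def SameBelAll (n c S T : ℕ) : Prop :=
  SameBel c (fullCode n) S T ∧ ∀ i < n, SameBel c (2 ^ i) S T

/-- Accessibility for all agents and for the full group. -/
def AccessAll (n c S T : ℕ) : Prop :=
  Access c (fullCode n) S T ∧ ∀ i < n, Access c (2 ^ i) S T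

/-- The type `S` makes knowledge of `J` true and believed. -/
def LocalGroup (c J S : ℕ) : Prop :=
  ∀ k < c + 1, (Has S (knowCode J k) → Has S k) ∧ (Has S (knowCode J k) → Has S (belCode J k))

/-- The conditions on a single type. -/
def LocalType (n c S : ℕ) : Prop :=
  (∀ k < c + 1, Has S (Nat.pair 1 k) ↔ ¬ Has S k) ∧
  (∀ k < c + 1, ∀ l < c + 1, Has S (Nat.pair 2 (Nat.pair k l)) ↔ Has S k ∧ Has S l) ∧
  (∀ i < n, LocalGroup c (2 ^ i) S) ∧ LocalGroup c (fullCode n) S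

/-- The set `M` of types below `b` contains, for the type `S`, the witnesses that agent `i` needs:
for each missing belief, for each missing item of knowledge, and for the final cluster. -/
def AgentWitness (c b M S i : ℕ) : Prop :=
  (∀ k < c + 1, ¬ Has S (belCode (2 ^ i) k) →
    ∃ T < b, Has M T ∧ SameBel c (2 ^ i) S T ∧ FinalType c (2 ^ i) T ∧ ¬ Has T k) ∧
  (∀ k < c + 1, ¬ Has S (knowCode (2 ^ i) k) →
    ∃ T < b, Has M T ∧ Access c (2 ^ i) S T ∧ ¬ Has T k) ∧
  ∃ T < b, Has M T ∧ SameBel c (2 ^ i) S T ∧ FinalType c (2 ^ i) T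

/-- The witnesses for the full group. A witness for missing knowledge may be final in the cell or
accessible for everybody. -/
def FullWitness (n c b M S : ℕ) : Prop :=
  (∀ k < c + 1, ¬ Has S (belCode (fullCode n) k) →
    ∃ T < b, Has M T ∧ SameBelAll n c S T ∧ FinalType c (fullCode n) T ∧ ¬ Has T k) ∧
  (∀ k < c + 1, ¬ Has S (knowCode (fullCode n) k) →
    ∃ T < b, Has M T ∧ (AccessAll n c S T ∨ SameBelAll n c S T ∧ FinalType c (fullCode n) T) ∧
      ¬ Has T k) ∧
  ∃ T < b, Has M T ∧ AccessAll n c S T ∧ FinalType c (fullCode n) T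

/-- `M` codes a set of types below `b` that supports a frame satisfying its own types. -/
def Saturated (n c b M : ℕ) : Prop :=
  ∀ S < b, Has M S → LocalType n c S ∧ (∀ i < n, AgentWitness c b M S i) ∧ FullWitness n c b M S

/-- All formulas relevant for the formulas numbered up to `c` have numbers below this bound. -/
def codeBound (n c : ℕ) : ℕ := Nat.pair 4 (Nat.pair (2 ^ n) (Nat.pair c c)) + 1

/-- There is a saturated set of types, one of which omits the formula number `c`. -/
def Refutable (n c : ℕ) : Prop :=
  ∃ M < 2 ^ 2 ^ codeBound n c, Saturated n c (2 ^ codeBound n c) M ∧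
    ∃ S < 2 ^ codeBound n c, Has M S ∧ ¬ Has S c

theorem SameBel.refl (c J S : ℕ) : SameBel c J S S := fun _ _ => Iff.rfl

theorem SameBel.symm {c J S T : ℕ} (h : SameBel c J S T) : SameBel c J T S :=
  fun k hk => (h k hk).symm

theorem SameBel.trans {c J S T U : ℕ} (h : SameBel c J S T) (h' : SameBel c J T U) :
    SameBel c J S U :=
  fun k hk => (h k hk).trans (h' k hk)

theorem Access.refl (c J S : ℕ) : Access c J S S := ⟨.refl c J S, fun _ _ => id⟩

theorem Access.trans {c J S T U : ℕ} (h : Access c J S T) (h' : Access c J T U) :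
    Access c J S U :=
  ⟨h.1.trans h'.1, fun k hk hS => h'.2 k hk (h.2 k hk hS)⟩

theorem FinalType.of_access {c J S T : ℕ} (h : FinalType c J S) (hST : Access c J S T) :
    FinalType c J T :=
  fun k hk hT => hST.2 k hk (h k hk ((hST.1 k hk).2 hT))

theorem Access.of_final {c J S T : ℕ} (hS : LocalGroup c J S) (h : SameBel c J S T)
    (hT : FinalType c J T) : Access c J S T :=
  ⟨h, fun k hk hk' => hT k hk ((h k hk).1 ((hS k hk).2 hk'))⟩

theorem code_single {n : ℕ} (i : Fin n) : (single i).code = 2 ^ (i : ℕ) := by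
  simp [Idx.code, single]

theorem code_full (n : ℕ) : (full n).code = fullCode n := by
  rw [fullCode, Idx.code, full, Fin.sum_univ_eq_sum_range (fun i => 2 ^ i) n,
    Nat.geomSum_eq le_rfl]
  simp

theorem Idx.code_injective {n : ℕ} : Function.Injective (Idx.code : Idx n → ℕ) := by
  intro I J h
  have h' := Finset.geomSum_injective (n := 2) le_rfl
    (a₁ := I.1.map Fin.valEmbedding) (a₂ := J.1.map Fin.valEmbedding)
    (by simpa [Idx.code] using h)
  exact Subtype.ext (Finset.map_injective _ h')

/-- For a single agent the full group is not a further case. -/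
theorem Idx.eq_single_or_full {n : ℕ} [NeZero n] (I : Idx n) :
    (∃ i, I = single i) ∨ 1 < n ∧ I = full n := by
  obtain ⟨I, hI | ⟨i, hI⟩⟩ := I
  · by_cases hn : 1 < n
    · exact Or.inr ⟨hn, Subtype.ext hI⟩
    · obtain rfl : n = 1 := by have := NeZero.pos n; omega
      exact Or.inl ⟨0, Subtype.ext (hI.trans rfl)⟩
  · exact Or.inl ⟨i, Subtype.ext hI⟩

namespace Saturated

variable {n c b M : ℕ}

/-- The frame of a saturated set of types. -/
def frame (h : Saturated n c b M) : Frame n (ULift.{v} {S : ℕ // S < b ∧ Has M S}) where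
  E i :=
    { r := fun x y => SameBel c (2 ^ (i : ℕ)) x.down.1 y.down.1
      iseqv := ⟨fun _ => .refl _ _ _, .symm, .trans⟩ }
  R i x y := Access c (2 ^ (i : ℕ)) x.down.1 y.down.1
  fin i := {x | FinalType c (2 ^ (i : ℕ)) x.down.1}
  EA :=
    { r := fun x y => SameBelAll n c x.down.1 y.down.1
      iseqv := ⟨fun _ => ⟨.refl _ _ _, fun _ _ => .refl _ _ _⟩,
        fun h => ⟨h.1.symm, fun i hi => (h.2 i hi).symm⟩,
        fun h h' => ⟨h.1.trans h'.1, fun i hi => (h.2 i hi).trans (h'.2 i hi)⟩⟩ }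
  D x y := AccessAll n c x.down.1 y.down.1
  finA := {x | FinalType c (fullCode n) x.down.1}
  R_refl _ _ := .refl _ _ _
  R_trans _ _ _ _ := .trans
  E_of_R _ _ _ h := h.1
  R_of_fin i x _ hE hf := .of_final ((h _ x.down.2.1 x.down.2.2).1.2.2.1 i i.2) hE hf
  fin_closed _ _ _ hx hR := hx.of_access hR
  exists_fin i x := by
    obtain ⟨T, hT, hMT, hE, hf⟩ := ((h _ x.down.2.1 x.down.2.2).2.1 i i.2).2.2
    exact ⟨⟨⟨T, hT, hMT⟩⟩, hE, hf⟩
  E_of_EA i _ _ h := h.2 i i.2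
  D_refl _ := ⟨.refl _ _ _, fun _ _ => .refl _ _ _⟩
  D_trans _ _ _ h h' := ⟨h.1.trans h'.1, fun i hi => (h.2 i hi).trans (h'.2 i hi)⟩
  EA_of_D _ _ h := ⟨h.1.1, fun i hi => (h.2 i hi).1⟩
  R_of_D i _ _ h := h.2 i i.2
  finA_closed _ _ hx hD := hx.of_access hD.1
  exists_finA x := by
    obtain ⟨T, hT, hMT, hD, hf⟩ := (h _ x.down.2.1 x.down.2.2).2.2.2.2
    exact ⟨⟨⟨T, hT, hMT⟩⟩, hD, hf⟩

variable {P : Type u} {e : P → ℕ}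

/-- The truth lemma: in the topo-e-model of a saturated set of types, a formula holds at a state if
and only if it belongs to the type of the state. -/
theorem mem_interp_iff [NeZero n] (h : Saturated n c b M)
    (label : ULift.{v} {S : ℕ // S < b ∧ Has M S} → ℤ)
    (hlabel : ∀ x y, label x = label y ↔ h.frame.EA x y) (φ : Formula P n) (hφ : φ.code e ≤ c)
    (x : Frame.State n (ULift.{v} {S : ℕ // S < b ∧ Has M S})) :
    x ∈ (h.frame.model label fun p => {y | Has y.down.1 (Nat.pair 0 (e p))}).interp φ ↔
      Has x.world.down.1 (φ.code e) := by
  have hx := fun x : Frame.State n (ULift.{v} {S : ℕ // S < b ∧ Has M S}) =>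
    h _ x.world.down.2.1 x.world.down.2.2
  induction φ generalizing x with
  | atom p => exact Iff.rfl
  | neg φ ih =>
    have hle : φ.code e ≤ c := (Nat.right_le_pair _ _).trans hφ
    exact (not_congr (ih hle x)).trans ((hx x).1.1 _ (Nat.lt_succ_of_le hle)).symm
  | and φ ψ ih₁ ih₂ =>
    have hle : Nat.pair (φ.code e) (ψ.code e) ≤ c := (Nat.right_le_pair _ _).trans hφ
    have hle₁ := (Nat.left_le_pair _ _).trans hle
    have hle₂ := (Nat.right_le_pair _ _).trans hle
    exact (and_congr (ih₁ hle₁ x) (ih₂ hle₂ x)).trans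
      ((hx x).1.2.1 _ (Nat.lt_succ_of_le hle₁) _ (Nat.lt_succ_of_le hle₂)).symm
  | bel I φ ih =>
    have hle : φ.code e ≤ c :=
      (Nat.right_le_pair _ _).trans ((Nat.right_le_pair _ _).trans hφ)
    have hlt := Nat.lt_succ_of_le hle
    have hS : (h.frame.model label fun p => {y | Has y.down.1 (Nat.pair 0 (e p))}).interp φ =
        {y | y.world ∈ {w | Has w.down.1 (φ.code e)}} := Set.ext fun y => ih hle y
    change x ∈ Model.B _ _ _ ↔ Has _ (belCode _ _)
    rw [hS]
    obtain ⟨i, rfl⟩ | ⟨hn, rfl⟩ := I.eq_single_or_full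
    · rw [code_single]
      refine (Frame.mem_B_single _ i x _).trans ⟨fun hw => ?_, fun hb w hE hf => ?_⟩
      · by_contra hn
        obtain ⟨T, hT, hMT, hE, hf, hTk⟩ := ((hx x).2.1 i i.2).1 _ hlt hn
        exact hTk (hw ⟨⟨T, hT, hMT⟩⟩ hE hf)
      · exact ((h _ w.down.2.1 w.down.2.2).1.2.2.1 i i.2 _ hlt).1
          (hf _ hlt ((hE _ hlt).1 hb))
    · rw [code_full]
      refine (Frame.mem_B_univ hn hlabel _ x _).trans ⟨fun hw => ?_, fun hb w hE hf => ?_⟩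
      · by_contra hn
        obtain ⟨T, hT, hMT, hE, hf, hTk⟩ := (hx x).2.2.1 _ hlt hn
        exact hTk (hw ⟨⟨T, hT, hMT⟩⟩ hE hf)
      · exact ((h _ w.down.2.1 w.down.2.2).1.2.2.2 _ hlt).1
          (hf _ hlt ((hE.1 _ hlt).1 hb))
  | know I φ ih =>
    have hle : φ.code e ≤ c :=
      (Nat.right_le_pair _ _).trans ((Nat.right_le_pair _ _).trans hφ)
    have hlt := Nat.lt_succ_of_le hle
    have hS : (h.frame.model label fun p => {y | Has y.down.1 (Nat.pair 0 (e p))}).interp φ =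
        {y | y.world ∈ {w | Has w.down.1 (φ.code e)}} := Set.ext fun y => ih hle y
    change x ∈ Model.K _ _ _ ↔ Has _ (knowCode _ _)
    rw [hS]
    obtain ⟨i, rfl⟩ | ⟨hn, rfl⟩ := I.eq_single_or_full
    · rw [code_single]
      refine (Frame.mem_K_single _ i x _).trans ⟨fun hw => ?_, fun hb w hR => ?_⟩
      · by_contra hn
        obtain ⟨T, hT, hMT, hR, hTk⟩ := ((hx x).2.1 i i.2).2.1 _ hlt hn
        exact hTk (hw ⟨⟨T, hT, hMT⟩⟩ hR)
      · exact ((h _ w.down.2.1 w.down.2.2).1.2.2.1 i i.2 _ hlt).1 (hR.2 _ hlt hb)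
    · rw [code_full]
      refine (Frame.mem_K_univ hn hlabel _ x _).trans
        ⟨fun hw => ?_, fun hb => ⟨fun w hD => ?_, fun w hE hf => ?_⟩⟩
      · by_contra hn
        obtain ⟨T, hT, hMT, hDE, hTk⟩ := (hx x).2.2.2.1 _ hlt hn
        rcases hDE with hD | ⟨hE, hf⟩
        · exact hTk (hw.1 ⟨⟨T, hT, hMT⟩⟩ hD)
        · exact hTk (hw.2 ⟨⟨T, hT, hMT⟩⟩ hE hf)
      · exact ((h _ w.down.2.1 w.down.2.2).1.2.2.2 _ hlt).1 (hD.1.2 _ hlt hb)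
      · exact ((h _ w.down.2.1 w.down.2.2).1.2.2.2 _ hlt).1
          (hf _ hlt ((hE.1 _ hlt).1 (((hx x).1.2.2.2 _ hlt).2 hb)))

end Saturated

theorem not_valid_of_refutable {P : Type u} {n : ℕ} [NeZero n] {e : P → ℕ} {φ : Formula P n}
    (h : Refutable n (φ.code e)) : ¬ Valid.{u, v} φ := by
  obtain ⟨M, -, hM, S, hS, hMS, hSφ⟩ := h
  obtain ⟨g, hg⟩ := exists_injective_nat (Quotient (hM.frame.EA))
  have hlabel : ∀ x y, ((g (Quotient.mk _ x) : ℕ) : ℤ) = (g (Quotient.mk _ y) : ℕ) ↔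
      hM.frame.EA x y := by
    intro x y
    rw [Nat.cast_inj, hg.eq_iff]
    exact Quotient.eq
  intro hv
  exact hSφ ((hM.mem_interp_iff _ hlabel φ le_rfl ⟨⟨⟨S, hS, hMS⟩⟩, 0, 0⟩).1 (hv _ _ _))

/-! ### Types of maximal consistent sets -/

section Decode

variable {P : Type u} {n : ℕ}

open Classical in
/-- The index of a group with the given number (the full group if there is none). -/
noncomputable def Idx.ofCode (n J : ℕ) : Idx n :=
  if h : ∃ I : Idx n, I.code = J then h.choose else full n

theorem Idx.ofCode_code (I : Idx n) : Idx.ofCode n I.code = I := by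
  have h : ∃ I' : Idx n, I'.code = I.code := ⟨I, rfl⟩
  rw [Idx.ofCode, dif_pos h]
  exact Idx.code_injective h.choose_spec

theorem unpair_unpair_le (m : ℕ) :
    m.unpair.2.unpair.1 ≤ m.unpair.2 ∧ m.unpair.2.unpair.2 ≤ m.unpair.2 :=
  ⟨Nat.unpair_left_le _, Nat.unpair_right_le _⟩

/-- A left inverse of the Gödel numbering, defined on all numbers in such a way that it respects the
connectives everywhere. A number that does not come from an atom or a connective is sent to the
atom `p₀`. -/
noncomputable def decode (n : ℕ) (e : P → ℕ) (p₀ : P) (m : ℕ) : Formula P n :=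
  have := Nat.unpair_add_le m
  have := unpair_unpair_le m
  if m.unpair.1 = 1 then .neg (decode n e p₀ m.unpair.2)
  else if m.unpair.1 = 2 then
    .and (decode n e p₀ m.unpair.2.unpair.1) (decode n e p₀ m.unpair.2.unpair.2)
  else if m.unpair.1 = 3 then
    .bel (.ofCode n m.unpair.2.unpair.1) (decode n e p₀ m.unpair.2.unpair.2)
  else if m.unpair.1 = 4 then
    .know (.ofCode n m.unpair.2.unpair.1) (decode n e p₀ m.unpair.2.unpair.2)
  else
    have : Nonempty P := ⟨p₀⟩
    .atom (Function.invFun e m.unpair.2)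
termination_by m
decreasing_by all_goals omega

variable (e : P → ℕ) (p₀ : P)

theorem decode_neg (k : ℕ) : decode n e p₀ (Nat.pair 1 k) = .neg (decode n e p₀ k) := by
  rw [decode]; simp

theorem decode_and (k l : ℕ) : decode n e p₀ (Nat.pair 2 (Nat.pair k l)) =
    .and (decode n e p₀ k) (decode n e p₀ l) := by
  rw [decode]; simp

theorem decode_bel (I : Idx n) (k : ℕ) : decode n e p₀ (belCode I.code k) =
    .bel I (decode n e p₀ k) := by
  rw [belCode, decode]; simp [Idx.ofCode_code]

theorem decode_know (I : Idx n) (k : ℕ) : decode n e p₀ (knowCode I.code k) =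
    .know I (decode n e p₀ k) := by
  rw [knowCode, decode]; simp [Idx.ofCode_code]

theorem decode_code {e : P → ℕ} (he : Function.Injective e) (φ : Formula P n) :
    decode n e p₀ (φ.code e) = φ := by
  induction φ with
  | atom p =>
    rw [Formula.code, decode]
    have : Nonempty P := ⟨p₀⟩
    simp [Function.leftInverse_invFun he p]
  | neg φ ih => rw [Formula.code, decode_neg, ih]
  | and φ ψ ih₁ ih₂ => rw [Formula.code, decode_and, ih₁, ih₂]
  | bel I φ ih => exact (decode_bel e p₀ I _).trans (by rw [ih])
  | know I φ ih => exact (decode_know e p₀ I _).trans (by rw [ih])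

end Decode

theorem pair_le_pair {a b c d : ℕ} (h : a ≤ c) (h' : b ≤ d) : Nat.pair a b ≤ Nat.pair c d :=
  (StrictMono.monotone (fun _ _ h => Nat.pair_lt_pair_left b h) h).trans
    (StrictMono.monotone (fun _ _ h => Nat.pair_lt_pair_right c h) h')

section Types

variable {n c : ℕ}

theorem lt_codeBound {t x : ℕ} (ht : t ≤ 4) (hx : x ≤ Nat.pair (2 ^ n) (Nat.pair c c)) :
    Nat.pair t x < codeBound n c :=
  Nat.lt_succ_of_le (pair_le_pair ht hx)

theorem pair_lt_codeBound {t a k : ℕ} (ht : t ≤ 4) (ha : a ≤ 2 ^ n) (hk : k < c + 1) :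
    Nat.pair t (Nat.pair a k) < codeBound n c :=
  lt_codeBound ht (pair_le_pair ha ((Nat.le_of_lt_succ hk).trans (Nat.left_le_pair c c)))

theorem code_le (I : Idx n) : I.code ≤ 2 ^ n := by
  obtain ⟨I, rfl | ⟨i, rfl⟩⟩ := I
  · exact (code_full n).trans_le (Nat.sub_le _ _)
  · exact (code_single i).trans_le (Nat.pow_le_pow_right two_pos i.2.le)

variable {P : Type u} (e : P → ℕ) (p₀ : P)

/-- `S` is the restriction of `Γ` to the formulas with numbers below the bound. -/
def IsTypeOf (c : ℕ) (Γ : Set (Formula P n)) (S : ℕ) : Prop :=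
  ∀ k < codeBound n c, Has S k ↔ decode n e p₀ k ∈ Γ

namespace IsTypeOf

variable {e p₀} {Γ Δ : Set (Formula P n)} {S T : ℕ} {I : Idx n} {k : ℕ}

theorem has (hS : IsTypeOf e p₀ c Γ S) (hk : k < c + 1) : Has S k ↔ decode n e p₀ k ∈ Γ := by
  refine hS k (Nat.lt_succ_of_le ((Nat.le_of_lt_succ hk).trans ?_))
  exact (Nat.left_le_pair c c).trans ((Nat.right_le_pair _ _).trans (Nat.right_le_pair _ _))

theorem has_bel (hS : IsTypeOf e p₀ c Γ S) (hk : k < c + 1) :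
    Has S (belCode I.code k) ↔ .bel I (decode n e p₀ k) ∈ Γ := by
  rw [← decode_bel]
  exact hS _ (pair_lt_codeBound (by norm_num) (code_le I) hk)

theorem has_know (hS : IsTypeOf e p₀ c Γ S) (hk : k < c + 1) :
    Has S (knowCode I.code k) ↔ .know I (decode n e p₀ k) ∈ Γ := by
  rw [← decode_know]
  exact hS _ (pair_lt_codeBound le_rfl (code_le I) hk)

theorem sameBel (hS : IsTypeOf e p₀ c Γ S) (hT : IsTypeOf e p₀ c Δ T)
    (h : ∀ χ, .bel I χ ∈ Γ ↔ .bel I χ ∈ Δ) : SameBel c I.code S T := by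
  intro k hk
  rw [hS.has_bel hk, hT.has_bel hk, h]

theorem access (hS : IsTypeOf e p₀ c Γ S) (hT : IsTypeOf e p₀ c Δ T)
    (h : IsWorld.Sees I Γ Δ) : Access c I.code S T := by
  refine ⟨hS.sameBel hT h.1, fun k hk => ?_⟩
  rw [hS.has_know hk, hT.has_know hk]
  exact h.2 _

theorem finalType (hT : IsTypeOf e p₀ c Δ T) (h : IsWorld.IsFinal I Δ) :
    FinalType c I.code T := by
  intro k hk
  rw [hT.has_bel hk, hT.has_know hk]
  exact h _

theorem accessAll (hS : IsTypeOf e p₀ c Γ S) (hT : IsTypeOf e p₀ c Δ T)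
    (h : IsWorld.Sees (full n) Γ Δ) (h' : ∀ i, IsWorld.Sees (single i) Γ Δ) :
    AccessAll n c S T :=
  ⟨code_full n ▸ hS.access hT h, fun i hi => code_single ⟨i, hi⟩ ▸ hS.access hT (h' ⟨i, hi⟩)⟩

variable [NeZero n]

theorem localGroup (hS : IsTypeOf e p₀ c Γ S) (h : IsWorld Γ) (I : Idx n) :
    LocalGroup c I.code S := by
  intro k hk
  rw [hS.has hk, hS.has_bel hk, hS.has_know hk]
  exact ⟨h.mp (.truthK _ _), h.mp (.knowBel _ _)⟩

theorem localType (hS : IsTypeOf e p₀ c Γ S) (h : IsWorld Γ) : LocalType n c S := by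
  refine ⟨fun k hk => ?_, fun k hk l hl => ?_, fun i hi => ?_, ?_⟩
  · rw [hS.has hk, ← h.neg_mem, ← decode_neg]
    refine hS _ (lt_codeBound (by norm_num) ((Nat.le_of_lt_succ hk).trans ?_))
    exact (Nat.left_le_pair c c).trans (Nat.right_le_pair _ _)
  · rw [hS.has hk, hS.has hl, ← h.and_mem, ← decode_and]
    refine hS _ (lt_codeBound (by norm_num) ((pair_le_pair (Nat.le_of_lt_succ hk)
      (Nat.le_of_lt_succ hl)).trans (Nat.right_le_pair _ _)))
  · exact code_single ⟨i, hi⟩ ▸ hS.localGroup h _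
  · exact code_full n ▸ hS.localGroup h _

theorem sameBelAll (hS : IsTypeOf e p₀ c Γ S) (hT : IsTypeOf e p₀ c Δ T)
    (h : IsWorld Γ) (h' : IsWorld Δ) (hk : ∀ χ, .know (full n) χ ∈ Γ → χ ∈ Δ) :
    SameBelAll n c S T :=
  ⟨code_full n ▸ hS.sameBel hT (h.sees_of_know h' hk).1, fun i hi =>
    code_single ⟨i, hi⟩ ▸ hS.sameBel hT (h.bel_single_iff_of_know_full h' hk ⟨i, hi⟩)⟩

section Witness

variable {b M : ℕ}

theorem agentWitness (hM : ∀ Δ : Set (Formula P n), IsWorld Δ →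
      ∃ T < b, Has M T ∧ IsTypeOf e p₀ c Δ T)
    (hS : IsTypeOf e p₀ c Γ S) (h : IsWorld Γ) (i : Fin n) : AgentWitness c b M S i := by
  rw [AgentWitness, ← code_single]
  refine ⟨fun k hk hn => ?_, fun k hk hn => ?_, ?_⟩
  · rw [hS.has_bel hk] at hn
    obtain ⟨Δ, hΔ, hb, hψ⟩ := h.exists_bel hn
    obtain ⟨T, hTb, hMT, hT⟩ := hM Δ hΔ
    exact ⟨T, hTb, hMT, hS.sameBel hT (h.sees_of_bel hΔ hb).1,
      hT.finalType (h.isFinal_of_bel hΔ hb), by rwa [hT.has hk]⟩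
  · rw [hS.has_know hk] at hn
    obtain ⟨Δ, hΔ, hb, hψ⟩ := h.exists_know hn
    obtain ⟨T, hTb, hMT, hT⟩ := hM Δ hΔ
    exact ⟨T, hTb, hMT, hS.access hT (h.sees_of_know hΔ hb), by rwa [hT.has hk]⟩
  · obtain ⟨Δ, hΔ, hb⟩ := h.exists_bel_nonempty (single i)
    obtain ⟨T, hTb, hMT, hT⟩ := hM Δ hΔ
    exact ⟨T, hTb, hMT, hS.sameBel hT (h.sees_of_bel hΔ hb).1,
      hT.finalType (h.isFinal_of_bel hΔ hb)⟩

theorem fullWitness (hM : ∀ Δ : Set (Formula P n), IsWorld Δ →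
      ∃ T < b, Has M T ∧ IsTypeOf e p₀ c Δ T)
    (hS : IsTypeOf e p₀ c Γ S) (h : IsWorld Γ) : FullWitness n c b M S := by
  have hbk : ∀ {Δ : Set (Formula P n)}, (∀ χ, .bel (full n) χ ∈ Γ → χ ∈ Δ) →
      ∀ χ, .know (full n) χ ∈ Γ → χ ∈ Δ := fun hb χ hχ => hb χ (h.mp (.knowBel _ _) hχ)
  have hbel : ∀ k < c + 1, ¬ Has S (belCode (fullCode n) k) →
      ∃ T < b, Has M T ∧ SameBelAll n c S T ∧ FinalType c (fullCode n) T ∧ ¬ Has T k := by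
    intro k hk hn
    rw [← code_full, hS.has_bel hk] at hn
    obtain ⟨Δ, hΔ, hb, hψ⟩ := h.exists_bel hn
    obtain ⟨T, hTb, hMT, hT⟩ := hM Δ hΔ
    exact ⟨T, hTb, hMT, hS.sameBelAll hT h hΔ (hbk hb),
      code_full n ▸ hT.finalType (h.isFinal_of_bel hΔ hb), by rwa [hT.has hk]⟩
  refine ⟨hbel, fun k hk hn => ?_, ?_⟩
  · by_cases hB : Has S (belCode (fullCode n) k)
    · rw [← code_full, hS.has_know hk] at hn
      rw [← code_full, hS.has_bel hk] at hB
      obtain ⟨Δ, hΔ, hb, hψ⟩ := h.exists_know hn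
      obtain ⟨T, hTb, hMT, hT⟩ := hM Δ hΔ
      exact ⟨T, hTb, hMT, Or.inl (hS.accessAll hT (h.sees_of_know hΔ hb)
        (h.sees_single_of_know_full hΔ hb hB hψ)), by rwa [hT.has hk]⟩
    · obtain ⟨T, hTb, hMT, hE, hf, hTk⟩ := hbel k hk hB
      exact ⟨T, hTb, hMT, Or.inr ⟨hE, hf⟩, hTk⟩
  · obtain ⟨Δ, hΔ, hb, hk⟩ := h.exists_final_sees
    obtain ⟨T, hTb, hMT, hT⟩ := hM Δ hΔ
    exact ⟨T, hTb, hMT, hS.accessAll hT (h.sees_of_bel hΔ hb)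
      (fun i => h.sees_of_know hΔ (hk i)), code_full n ▸ hT.finalType (h.isFinal_of_bel hΔ hb)⟩

end Witness

end IsTypeOf

/-- The types of all worlds form a saturated set, which refutes every formula without a proof. -/
theorem refutable_of_not_provable [NeZero n] {e : P → ℕ} (he : Function.Injective e)
    {φ : Formula P n} (h : ¬ Provable φ) : Refutable n (φ.code e) := by
  -- The decoding of numbers needs an atom; without atoms there are no formulas.
  cases isEmpty_or_nonempty P with
  | inl hP =>
    have hF : Formula P n → False := fun φ => by
      induction φ with
      | atom p => exact hP.false p
      | _ => assumption
    exact (hF φ).elim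
  | inr hP =>
    obtain ⟨p₀⟩ := hP
    obtain ⟨Γ, hΓ, -, hφ⟩ :=
      exists_isWorld (Γ := ∅) fun hd : Derivable _ φ => h hd.provable_of_empty
    set c := φ.code e
    obtain ⟨M, hMlt, hM⟩ := exists_has
      (fun S => ∃ Δ : Set (Formula P n), IsWorld Δ ∧ IsTypeOf e p₀ c Δ S) (2 ^ codeBound n c)
    have hM' : ∀ Δ : Set (Formula P n), IsWorld Δ →
        ∃ T < 2 ^ codeBound n c, Has M T ∧ IsTypeOf e p₀ c Δ T := by
      intro Δ hΔ
      obtain ⟨T, hTlt, hT⟩ := exists_has (fun k => decode n e p₀ k ∈ Δ) (codeBound n c)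
      exact ⟨T, hTlt, (hM T hTlt).2 ⟨Δ, hΔ, hT⟩, hT⟩
    refine ⟨M, hMlt, fun S hS hMS => ?_, ?_⟩
    · obtain ⟨Δ, hΔ, hT⟩ := (hM S hS).1 hMS
      exact ⟨hT.localType hΔ, fun i hi => hT.agentWitness hM' hΔ ⟨i, hi⟩,
        hT.fullWitness hM' hΔ⟩
    · obtain ⟨T, hTlt, hMT, hT⟩ := hM' Γ hΓ
      refine ⟨T, hTlt, hMT, ?_⟩
      rwa [hT.has (Nat.lt_succ_self c), decode_code p₀ he]

end Types

/-! ### Primitive recursiveness and decidability -/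

section Computability

variable {α : Type*} [Primcodable α]

theorem primrec_two_pow : Primrec fun k : ℕ => 2 ^ k := by
  refine (Primrec.nat_rec₁ 1 (Primrec.nat_mul.comp₂ (Primrec₂.const 2) Primrec₂.right)).of_eq
    fun k => ?_
  induction k with
  | zero => rfl
  | succ k ih => rw [pow_succ, ← ih, mul_comm]

theorem _root_.Primrec.two_pow {f : α → ℕ} (hf : Primrec f) : Primrec fun a => 2 ^ f a :=
  primrec_two_pow.comp hf

theorem _root_.PrimrecPred.forall_lt_comp {f : α → ℕ} (hf : Primrec f) {p : α → ℕ → Prop}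
    (hp : PrimrecPred fun x : α × ℕ => p x.1 x.2) : PrimrecPred fun a => ∀ k < f a, p a k :=
  ((PrimrecRel.forall_mem_list (R := fun (k : ℕ) (a : α) => p a k)
    (hp.comp (Primrec.snd.pair Primrec.fst))).comp (Primrec.list_range.comp hf) Primrec.id).of_eq
    fun a => by simp

theorem _root_.PrimrecPred.exists_lt_comp {f : α → ℕ} (hf : Primrec f) {p : α → ℕ → Prop}
    (hp : PrimrecPred fun x : α × ℕ => p x.1 x.2) : PrimrecPred fun a => ∃ k < f a, p a k :=
  ((PrimrecRel.exists_mem_list (R := fun (k : ℕ) (a : α) => p a k)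
    (hp.comp (Primrec.snd.pair Primrec.fst))).comp (Primrec.list_range.comp hf) Primrec.id).of_eq
    fun a => by simp

theorem _root_.PrimrecPred.imp {p q : α → Prop} (hp : PrimrecPred p) (hq : PrimrecPred q) :
    PrimrecPred fun a => p a → q a :=
  (hp.not.or hq).of_eq fun _ => imp_iff_not_or.symm

theorem _root_.PrimrecPred.iff {p q : α → Prop} (hp : PrimrecPred p) (hq : PrimrecPred q) :
    PrimrecPred fun a => p a ↔ q a :=
  ((hp.imp hq).and (hq.imp hp)).of_eq fun _ => iff_def.symm

variable {c b M S T J k : α → ℕ} (n : ℕ)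

theorem primrecPred_has (hS : Primrec S) (hk : Primrec k) :
    PrimrecPred fun a => Has (S a) (k a) :=
  Primrec.eq.comp (Primrec.nat_mod.comp (Primrec.nat_div.comp hS hk.two_pow) (Primrec.const 2))
    (Primrec.const 1)

theorem primrec_belCode (hJ : Primrec J) (hk : Primrec k) :
    Primrec fun a => belCode (J a) (k a) :=
  Primrec₂.natPair.comp (Primrec.const 3) (Primrec₂.natPair.comp hJ hk)

theorem primrec_knowCode (hJ : Primrec J) (hk : Primrec k) :
    Primrec fun a => knowCode (J a) (k a) :=
  Primrec₂.natPair.comp (Primrec.const 4) (Primrec₂.natPair.comp hJ hk)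

theorem primrecPred_sameBel (hc : Primrec c) (hJ : Primrec J) (hS : Primrec S) (hT : Primrec T) :
    PrimrecPred fun a => SameBel (c a) (J a) (S a) (T a) := by
  refine .forall_lt_comp (Primrec.succ.comp hc) (.iff ?_ ?_)
  · exact primrecPred_has (hS.comp .fst) (primrec_belCode (hJ.comp .fst) .snd)
  · exact primrecPred_has (hT.comp .fst) (primrec_belCode (hJ.comp .fst) .snd)

theorem primrecPred_access (hc : Primrec c) (hJ : Primrec J) (hS : Primrec S) (hT : Primrec T) :
    PrimrecPred fun a => Access (c a) (J a) (S a) (T a) := by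
  refine .and (primrecPred_sameBel hc hJ hS hT)
    (.forall_lt_comp (Primrec.succ.comp hc) (.imp ?_ ?_))
  · exact primrecPred_has (hS.comp .fst) (primrec_knowCode (hJ.comp .fst) .snd)
  · exact primrecPred_has (hT.comp .fst) (primrec_knowCode (hJ.comp .fst) .snd)

theorem primrecPred_finalType (hc : Primrec c) (hJ : Primrec J) (hT : Primrec T) :
    PrimrecPred fun a => FinalType (c a) (J a) (T a) := by
  refine .forall_lt_comp (Primrec.succ.comp hc) (.imp ?_ ?_)
  · exact primrecPred_has (hT.comp .fst) (primrec_belCode (hJ.comp .fst) .snd)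
  · exact primrecPred_has (hT.comp .fst) (primrec_knowCode (hJ.comp .fst) .snd)

theorem primrecPred_sameBelAll (hc : Primrec c) (hS : Primrec S) (hT : Primrec T) :
    PrimrecPred fun a => SameBelAll n (c a) (S a) (T a) :=
  .and (primrecPred_sameBel hc (.const _) hS hT) (.forall_lt_comp (.const n)
    (primrecPred_sameBel (hc.comp .fst) (Primrec.two_pow .snd) (hS.comp .fst) (hT.comp .fst)))

theorem primrecPred_accessAll (hc : Primrec c) (hS : Primrec S) (hT : Primrec T) :
    PrimrecPred fun a => AccessAll n (c a) (S a) (T a) :=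
  .and (primrecPred_access hc (.const _) hS hT) (.forall_lt_comp (.const n)
    (primrecPred_access (hc.comp .fst) (Primrec.two_pow .snd) (hS.comp .fst) (hT.comp .fst)))

theorem primrecPred_localGroup (hc : Primrec c) (hJ : Primrec J) (hS : Primrec S) :
    PrimrecPred fun a => LocalGroup (c a) (J a) (S a) := by
  have hk : PrimrecPred fun x : α × ℕ => Has (S x.1) (knowCode (J x.1) x.2) :=
    primrecPred_has (hS.comp .fst) (primrec_knowCode (hJ.comp .fst) .snd)
  exact .forall_lt_comp (Primrec.succ.comp hc) (.and
    (hk.imp (primrecPred_has (hS.comp .fst) .snd))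
    (hk.imp (primrecPred_has (hS.comp .fst) (primrec_belCode (hJ.comp .fst) .snd))))

theorem primrecPred_localType (hc : Primrec c) (hS : Primrec S) :
    PrimrecPred fun a => LocalType n (c a) (S a) := by
  have hc1 : Primrec fun a => c a + 1 := Primrec.succ.comp hc
  refine .and (.forall_lt_comp hc1 (.iff ?_ (.not ?_)))
    (.and (.forall_lt_comp hc1 (.forall_lt_comp (hc1.comp .fst) (.iff ?_ (.and ?_ ?_))))
      (.and (.forall_lt_comp (.const n) ?_) (primrecPred_localGroup hc (.const _) hS)))
  · exact primrecPred_has (hS.comp .fst) (Primrec₂.natPair.comp (.const 1) .snd)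
  · exact primrecPred_has (hS.comp .fst) .snd
  · exact primrecPred_has (hS.comp (Primrec.fst.comp .fst)) (Primrec₂.natPair.comp (.const 2)
      (Primrec₂.natPair.comp (Primrec.snd.comp .fst) .snd))
  · exact primrecPred_has (hS.comp (Primrec.fst.comp .fst)) (Primrec.snd.comp .fst)
  · exact primrecPred_has (hS.comp (Primrec.fst.comp .fst)) .snd
  · exact primrecPred_localGroup (hc.comp .fst) (Primrec.two_pow .snd) (hS.comp .fst)

theorem primrecPred_agentWitness {i : α → ℕ} (hc : Primrec c) (hb : Primrec b) (hM : Primrec M)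
    (hS : Primrec S) (hi : Primrec i) :
    PrimrecPred fun a => AgentWitness (c a) (b a) (M a) (S a) (i a) := by
  have hc1 : Primrec fun a => c a + 1 := Primrec.succ.comp hc
  have h₁ : Primrec fun x : (α × ℕ) × ℕ => x.1.1 := Primrec.fst.comp .fst
  have hk : Primrec fun x : (α × ℕ) × ℕ => x.1.2 := Primrec.snd.comp .fst
  refine .and (.forall_lt_comp hc1 (.imp (.not ?_) (.exists_lt_comp (hb.comp .fst)
    (.and ?_ (.and ?_ (.and ?_ (.not ?_))))))) (.and (.forall_lt_comp hc1 (.imp (.not ?_)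
    (.exists_lt_comp (hb.comp .fst) (.and ?_ (.and ?_ (.not ?_))))))
    (.exists_lt_comp hb (.and ?_ (.and ?_ ?_))))
  · exact primrecPred_has (hS.comp .fst) (primrec_belCode (Primrec.two_pow (hi.comp .fst)) .snd)
  · exact primrecPred_has (hM.comp h₁) .snd
  · exact primrecPred_sameBel (hc.comp h₁) (Primrec.two_pow (hi.comp h₁)) (hS.comp h₁) .snd
  · exact primrecPred_finalType (hc.comp h₁) (Primrec.two_pow (hi.comp h₁)) .snd
  · exact primrecPred_has .snd hk
  · exact primrecPred_has (hS.comp .fst) (primrec_knowCode (Primrec.two_pow (hi.comp .fst)) .snd)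
  · exact primrecPred_has (hM.comp h₁) .snd
  · exact primrecPred_access (hc.comp h₁) (Primrec.two_pow (hi.comp h₁)) (hS.comp h₁) .snd
  · exact primrecPred_has .snd hk
  · exact primrecPred_has (hM.comp .fst) .snd
  · exact primrecPred_sameBel (hc.comp .fst) (Primrec.two_pow (hi.comp .fst)) (hS.comp .fst) .snd
  · exact primrecPred_finalType (hc.comp .fst) (Primrec.two_pow (hi.comp .fst)) .snd

theorem primrecPred_fullWitness (hc : Primrec c) (hb : Primrec b) (hM : Primrec M)
    (hS : Primrec S) : PrimrecPred fun a => FullWitness n (c a) (b a) (M a) (S a) := by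
  have hc1 : Primrec fun a => c a + 1 := Primrec.succ.comp hc
  have h₁ : Primrec fun x : (α × ℕ) × ℕ => x.1.1 := Primrec.fst.comp .fst
  have hk : Primrec fun x : (α × ℕ) × ℕ => x.1.2 := Primrec.snd.comp .fst
  refine .and (.forall_lt_comp hc1 (.imp (.not ?_) (.exists_lt_comp (hb.comp .fst)
    (.and ?_ (.and ?_ (.and ?_ (.not ?_))))))) (.and (.forall_lt_comp hc1 (.imp (.not ?_)
    (.exists_lt_comp (hb.comp .fst) (.and ?_ (.and (.or ?_ (.and ?_ ?_)) (.not ?_))))))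
    (.exists_lt_comp hb (.and ?_ (.and ?_ ?_))))
  · exact primrecPred_has (hS.comp .fst) (primrec_belCode (.const _) .snd)
  · exact primrecPred_has (hM.comp h₁) .snd
  · exact primrecPred_sameBelAll n (hc.comp h₁) (hS.comp h₁) .snd
  · exact primrecPred_finalType (hc.comp h₁) (.const _) .snd
  · exact primrecPred_has .snd hk
  · exact primrecPred_has (hS.comp .fst) (primrec_knowCode (.const _) .snd)
  · exact primrecPred_has (hM.comp h₁) .snd
  · exact primrecPred_accessAll n (hc.comp h₁) (hS.comp h₁) .snd
  · exact primrecPred_sameBelAll n (hc.comp h₁) (hS.comp h₁) .snd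
  · exact primrecPred_finalType (hc.comp h₁) (.const _) .snd
  · exact primrecPred_has .snd hk
  · exact primrecPred_has (hM.comp .fst) .snd
  · exact primrecPred_accessAll n (hc.comp .fst) (hS.comp .fst) .snd
  · exact primrecPred_finalType (hc.comp .fst) (.const _) .snd

theorem primrecPred_saturated (hc : Primrec c) (hb : Primrec b) (hM : Primrec M) :
    PrimrecPred fun a => Saturated n (c a) (b a) (M a) := by
  have h₁ : Primrec fun x : (α × ℕ) × ℕ => x.1.1 := Primrec.fst.comp .fst
  refine .forall_lt_comp hb (.imp (primrecPred_has (hM.comp .fst) .snd)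
    (.and (primrecPred_localType n (hc.comp .fst) .snd)
      (.and (.forall_lt_comp (.const n) ?_) ?_)))
  · exact primrecPred_agentWitness (hc.comp h₁) (hb.comp h₁) (hM.comp h₁)
      (Primrec.snd.comp .fst) .snd
  · exact primrecPred_fullWitness n (hc.comp .fst) (hb.comp .fst) (hM.comp .fst) .snd

theorem primrecPred_refutable : PrimrecPred (Refutable n) := by
  have hb : Primrec fun c => 2 ^ codeBound n c :=
    Primrec.two_pow (Primrec.succ.comp (Primrec₂.natPair.comp (.const 4)
      (Primrec₂.natPair.comp (.const _) (Primrec₂.natPair.comp .id .id))))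
  refine .exists_lt_comp hb.two_pow (.and ?_ (.exists_lt_comp (hb.comp .fst) (.and ?_ (.not ?_))))
  · exact primrecPred_saturated n .fst (hb.comp .fst) .snd
  · exact primrecPred_has (Primrec.snd.comp .fst) .snd
  · exact primrecPred_has .snd (Primrec.fst.comp .fst)

end Computability

/-- The numbering of the atoms serves only to make the types finite sets of numbers. -/
theorem valid_iff_provable {P : Type u} [Countable P] {n : ℕ} [NeZero n] (φ : Formula P n) :
    Valid.{u, v} φ ↔ Provable φ := by
  obtain ⟨e, he⟩ := exists_injective_nat P
  refine ⟨fun h => ?_, fun h X M x => h.mem_interp M x⟩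
  by_contra hn
  exact not_valid_of_refutable (refutable_of_not_provable he hn) h

theorem valid_iff_not_refutable {P : Type u} {n : ℕ} [NeZero n] {e : P → ℕ}
    (he : Function.Injective e) (φ : Formula P n) :
    Valid.{u, v} φ ↔ ¬ Refutable n (φ.code e) := by
  refine ⟨fun h hr => not_valid_of_refutable hr h, fun h X M x => ?_⟩
  by_contra hn
  exact h (refutable_of_not_provable he fun hp => hn (hp.mem_interp M x))

end TopoE

theorem theorem8 (P : Type u) [Countable P] (n : ℕ) [NeZero n] :
    -- soundness
    (∀ φ : TopoE.Formula P n, TopoE.Provable φ → TopoE.Valid.{u, v} φ) ∧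
    -- completeness
    (∀ φ : TopoE.Formula P n, TopoE.Valid.{u, v} φ → TopoE.Provable φ) ∧
    -- decidability of the logic
    TopoE.IsDecidable {φ : TopoE.Formula P n | TopoE.Valid.{u, v} φ} := by
  refine ⟨fun φ => (TopoE.valid_iff_provable φ).2, fun φ => (TopoE.valid_iff_provable φ).1,
    fun e he => ?_⟩
  obtain ⟨hdec, hprim⟩ := (TopoE.primrecPred_refutable n).not
  refine ⟨fun c => decide (¬ TopoE.Refutable n c), hprim.to_comp, fun φ => ?_⟩
  rw [decide_eq_true_iff]
  exact (TopoE.valid_iff_not_refutable he φ).symm
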